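/- For every $n\ge 1$ let $X_1=X_1^{(n)},\dots,X_n=X_n^{(n)}$ be independent real random variables on some probability space, with distribution functions $F_{n,1},\dots,F_{n,n}$ and average distribution function $\bar F_n=n^{-1}\sum_{i=1}^n F_{n,i}$, which is assumed to be continuous. The quantile function of a distribution function $F$ is its left-continuous inverse $u\mapsto\inf\{x: u\le F(x)\}$; $\bar Q_n$ denotes the quantile function of $\bar F_n$, $\widehat F(x)=n^{-1}\sum_{i=1}^n \mathbf 1\{X_i\le x\}$ the empirical distribution function, and $\widehat Q$ the empirical quantile function. Suppose that (Assumption 1) for every $n\ge 2$ the set $\{1,\dots,n\}$ is partitioned into groups $\mathcal I_{n,1},\dots,\mathcal I_{n,g}$ ($g$ may depend on $n$) of sizes $m_1,\dots,m_g$, all $m_j\ge 2$, such that $F_{n,i}=F_{n,i'}$ whenever $i,i'$ lie in the same group. Let $\tau\in(0,1)$, put $$V_n(\tau)=\frac1n\sum_{i=1}^n F_{n,i}(\bar Q_n(\tau))\{1-F_{n,i}(\bar Q_n(\tau))\},\qquad \widehat V(\tau)=\frac1n\sum_{j=1}^g\frac1{m_j-1}\sum_{\ell_1,\ell_2\in\mathcal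 I_{n,j}}\mathbf 1\{X_{\ell_1}\le\widehat Q(\tau),\ X_{\ell_2}>\widehat Q(\tau)\},$$ and suppose that (Assumption 2) $nV_n(\tau)\to\infty$ as $n\to\infty$. Then $$\left(\frac{n}{\widehat V(\tau)}\right)^{1/2}\bigl(\widehat F(\bar Q_n(\tau))-\tau\bigr)\xrightarrow{d}\mathcal N(0,1)\qquad(n\to\infty).$$ Moreover, for every $\alpha\in(0,1)$, with $\widehat c(\alpha)=\sqrt{\widehat V(\tau)/n}\;\Phi^{-1}(1-\alpha/2)$, where $\Phi^{-1}$ is the standard normal quantile function, $$P\bigl(\widehat Q(\tau-\widehat c(\alpha))<\bar Q_n(\tau)<\widehat Q(\tau+\widehat c(\alpha))\bigr)\to 1-\alpha .$$ (The statistic is given the value $0$ when $\widehat V(\tau)=0$; the probability of this event tends to $0$.) -/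

import Mathlib

open MeasureTheory ProbabilityTheory Filter Topology

noncomputable section

namespace HetQuantile

/-- The quantile function (left-continuous inverse) of a distribution function `F` on the line,
`u ↦ inf {x | u ≤ F x}`. -/
def quantile (F : ℝ → ℝ) (u : ℝ) : ℝ := sInf {x : ℝ | u ≤ F x}

section Population

variable {Ω : Type*} [MeasurableSpace Ω]

/-- The distribution function `x ↦ P (Y ≤ x)` of a real random variable `Y`. -/
def distFun (P : Measure Ω) (Y : Ω → ℝ) : ℝ → ℝ := fun x => cdf (P.map Y) x

/-- The average distribution function `n⁻¹ (F₁ + ⋯ + Fₙ)` of `n` random variables. -/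
def avgDistFun (P : Measure Ω) {n : ℕ} (X : Fin n → Ω → ℝ) : ℝ → ℝ :=
  fun x => (n : ℝ)⁻¹ * ∑ i, distFun P (X i) x

/-- The quantile function of the average distribution. -/
def avgQuantile (P : Measure Ω) {n : ℕ} (X : Fin n → Ω → ℝ) : ℝ → ℝ :=
  quantile (avgDistFun P X)

/-- The variance `V(τ) = n⁻¹ ∑ᵢ Fᵢ(q) (1 - Fᵢ(q))` at the quantile `q` of level `τ` of the
average distribution. -/
def avgVar (P : Measure Ω) {n : ℕ} (X : Fin n → Ω → ℝ) (τ : ℝ) : ℝ :=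
  (n : ℝ)⁻¹ * ∑ i, distFun P (X i) (avgQuantile P X τ) *
    (1 - distFun P (X i) (avgQuantile P X τ))

end Population

section Sample

/-- The empirical distribution function of the data `x₁, …, xₙ`. -/
def empDistFun {n : ℕ} (x : Fin n → ℝ) : ℝ → ℝ :=
  fun t => (n : ℝ)⁻¹ * ∑ i, if x i ≤ t then (1 : ℝ) else 0

/-- The empirical quantile function. -/
def empQuantile {n : ℕ} (x : Fin n → ℝ) : ℝ → ℝ := quantile (empDistFun x)

/-- The grouped variance estimator
`n⁻¹ ∑_J (m_J - 1)⁻¹ #{(k, l) ∈ J × J | x_k ≤ q < x_l}`, where `J` runs over the groups of the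
partition `I`, `m_J` is the size of `J` and `q` is the empirical quantile of level `τ`. -/
def varEst {n : ℕ} (I : Finpartition (Finset.univ : Finset (Fin n))) (x : Fin n → ℝ) (τ : ℝ) :
    ℝ :=
  (n : ℝ)⁻¹ * ∑ J ∈ I.parts, ((J.card : ℝ) - 1)⁻¹ *
    ∑ k ∈ J, ∑ l ∈ J,
      if x k ≤ empQuantile x τ ∧ empQuantile x τ < x l then (1 : ℝ) else 0

/-- The half-width `√(V̂(τ) / n) Φ⁻¹(1 - α / 2)` on the level scale, with `Φ` the standard normal
distribution function. -/
def halfWidth {n : ℕ} (I : Finpartition (Finset.univ : Finset (Fin n))) (x : Fin n → ℝ)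
    (τ α : ℝ) : ℝ :=
  Real.sqrt (varEst I x τ / n) * quantile (fun t => cdf (gaussianReal 0 1) t) (1 - α / 2)

end Sample

end HetQuantile

end

open HetQuantile

/-!
By the central limit theorem for bounded centred arrays, the statistic normalised by the true
variance `V` is asymptotically standard normal, so by Slutsky's theorem everything reduces to the
ratio consistency `V̂ / V → 1` in probability.

If `N` of the `m` observations in a group lie below `q`, the group contributes `N (m - N) / (m - 1)`
to `n V̂`. Moving `q` from the true to the empirical quantile changes the sum of these terms by at
most twice the number of observations in between, which is of order `√(n V)`. At a fixed `q`, with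
`p` the common value of the distribution functions of the group, the contribution minus its mean
`m p (1 - p)` is `(1 - 2 p) S - D / (m - 1)`, where `S` is the sum of the centred indicators and `D`
the degenerate quadratic form in them. As `D` is orthogonal to linear forms, the variance of the
contribution is at most its mean. So `n V̂` has mean `n V` up to `O (√(n V))` and standard deviation
`O (√(n V))`, and `n V → ∞` concludes.

Finally, since almost surely no observation equals the true quantile, on `V̂ > 0` the interval event
says exactly that the studentized statistic lies in `[-z, z)` with `z = Φ⁻¹(1 - α / 2)`.
-/

namespace HetQuantile

section VaryingSpaces

variable {ι Ω₀ E : Type*} {Ω : ι → Type*} {mΩ : ∀ i, MeasurableSpace (Ω i)}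
  {P : (i : ι) → Measure (Ω i)} [∀ i, IsProbabilityMeasure (P i)]
  {mΩ₀ : MeasurableSpace Ω₀} {μ : Measure Ω₀} [IsProbabilityMeasure μ]
  {l : Filter ι}

/-- Convergence in probability of `Y i` to the constant `c`. The probability space may depend on
`i`, which `TendstoInMeasure` does not allow. -/
def TendstoInProbConst [PseudoMetricSpace E] (P : (i : ι) → Measure (Ω i))
    (Y : (i : ι) → Ω i → E) (l : Filter ι) (c : E) : Prop :=
  ∀ ε > 0, Tendsto (fun i => (P i).real {ω | ε ≤ dist (Y i ω) c}) l (𝓝 0)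

theorem TendstoInProbConst.comp_continuousAt {F : Type*} [PseudoMetricSpace E]
    [PseudoMetricSpace F] {Y : (i : ι) → Ω i → E} {c : E} (hY : TendstoInProbConst P Y l c)
    {g : E → F} (hg : ContinuousAt g c) :
    TendstoInProbConst P (fun i ω => g (Y i ω)) l (g c) := by
  intro ε hε
  obtain ⟨δ, hδ, hgδ⟩ := Metric.continuousAt_iff.1 hg ε hε
  refine squeeze_zero (fun i => measureReal_nonneg) (fun i => measureReal_mono ?_) (hY δ hδ)
  exact fun ω hω => show δ ≤ dist (Y i ω) c from
    le_of_not_gt fun hlt => (hgδ hlt).not_ge hω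

theorem tendstoInDistribution_of_eventually_map_eq {Ω' : ι → Type*}
    {mΩ' : ∀ i, MeasurableSpace (Ω' i)} {P' : (i : ι) → Measure (Ω' i)}
    [∀ i, IsProbabilityMeasure (P' i)] [TopologicalSpace E] [MeasurableSpace E]
    [OpensMeasurableSpace E] {Z : Ω₀ → E} {X : (i : ι) → Ω i → E} {Y : (i : ι) → Ω' i → E}
    (hX : TendstoInDistribution X l Z P μ) (hY : ∀ i, AEMeasurable (Y i) (P' i))
    (hXY : ∀ᶠ i in l, (P i).map (X i) = (P' i).map (Y i)) :
    TendstoInDistribution Y l Z P' μ := by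
  refine ⟨hY, hX.aemeasurable_limit, hX.tendsto.congr' ?_⟩
  filter_upwards [hXY] with i hi using Subtype.ext hi

theorem TendstoInProbConst.mul_tendstoInDistribution [l.IsCountablyGenerated]
    {X Y : (i : ι) → Ω i → ℝ} {c : ℝ} (hY : TendstoInProbConst P Y l c)
    (hYm : ∀ i, AEMeasurable (Y i) (P i)) (hX : TendstoInDistribution X l Z P μ) :
    TendstoInDistribution (fun i ω => Y i ω * X i ω) l (fun ω => c * Z ω) P μ := by
  have heval : ∀ i, MeasurePreserving (Function.eval i) (Measure.infinitePi P) (P i) :=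
    measurePreserving_eval_infinitePi P
  have hXm := hX.forall_aemeasurable
  have hmap : ∀ i {W : Ω i → ℝ}, AEMeasurable W (P i) →
      (Measure.infinitePi P).map (fun ω => W (ω i)) = (P i).map W := fun i W hW => by
    conv_rhs => rw [← (heval i).map_eq]
    exact (AEMeasurable.map_map_of_aemeasurable ((heval i).map_eq.symm ▸ hW)
      (heval i).aemeasurable).symm
  have hXπ : TendstoInDistribution (fun i (ω : Π j, Ω j) => X i (ω i)) l Z
      (fun _ => Measure.infinitePi P) μ :=
    tendstoInDistribution_of_eventually_map_eq hX
      (fun i => (hXm i).comp_quasiMeasurePreserving (heval i).quasiMeasurePreserving)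
      (Eventually.of_forall fun i => (hmap i (hXm i)).symm)
  have hYπ : TendstoInMeasure (Measure.infinitePi P) (fun i ω => Y i (ω i)) l fun _ => c := by
    refine tendstoInMeasure_iff_measureReal_dist.2 fun ε hε => (hY ε hε).congr fun i => ?_
    exact ((heval i).measureReal_preimage (nullMeasurableSet_le aemeasurable_const
      ((hYm i).dist aemeasurable_const))).symm
  exact tendstoInDistribution_of_eventually_map_eq
    (hXπ.continuous_comp_prodMk_of_tendstoInMeasure_const (g := fun x : ℝ × ℝ => x.2 * x.1)
      (by fun_prop) hYπ fun i =>
        (hYm i).comp_quasiMeasurePreserving (heval i).quasiMeasurePreserving)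
    (fun i => (hYm i).mul (hXm i)) (Eventually.of_forall fun i => hmap i ((hYm i).mul (hXm i)))

theorem tendsto_measureReal_of_tendstoInDistribution [TopologicalSpace E] [MeasurableSpace E]
    [OpensMeasurableSpace E] [HasOuterApproxClosed E] {Z : Ω₀ → E} {X : (i : ι) → Ω i → E}
    (hX : TendstoInDistribution X l Z P μ) {A : Set E} (hA : MeasurableSet A)
    (hnull : μ.map Z (frontier A) = 0) :
    Tendsto (fun i => (P i).real {ω | X i ω ∈ A}) l (𝓝 ((μ.map Z).real A)) := by
  have h := ProbabilityMeasure.tendsto_measure_of_null_frontier_of_tendsto' hX.tendsto hnull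
  have := Measure.isProbabilityMeasure_map hX.aemeasurable_limit
  refine ((ENNReal.tendsto_toReal (measure_ne_top (μ.map Z) A)).comp h).congr fun i => ?_
  exact congrArg ENNReal.toReal (Measure.map_apply_of_aemeasurable (hX.forall_aemeasurable i) hA)

end VaryingSpaces

section BoundedArrays

theorem norm_prod_sub_prod_le_sum {R ι : Type*} [NormedCommRing R] [NormOneClass R]
    (s : Finset ι) {a b : ι → R} (ha : ∀ i ∈ s, ‖a i‖ ≤ 1) (hb : ∀ i ∈ s, ‖b i‖ ≤ 1) :
    ‖∏ i ∈ s, a i - ∏ i ∈ s, b i‖ ≤ ∑ i ∈ s, ‖a i - b i‖ := by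
  classical
  induction s using Finset.induction_on with
  | empty => simp
  | insert j s hj ih =>
    rw [Finset.forall_mem_insert] at ha hb
    have hprod : ‖∏ i ∈ s, b i‖ ≤ 1 :=
      (s.norm_prod_le b).trans (Finset.prod_le_one (fun _ _ => norm_nonneg _) hb.2)
    rw [Finset.prod_insert hj, Finset.prod_insert hj, Finset.sum_insert hj]
    calc ‖a j * ∏ i ∈ s, a i - b j * ∏ i ∈ s, b i‖
        = ‖(a j - b j) * ∏ i ∈ s, b i + a j * (∏ i ∈ s, a i - ∏ i ∈ s, b i)‖ := by
          congr 1; ring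
      _ ≤ ‖a j - b j‖ * ‖∏ i ∈ s, b i‖ + ‖a j‖ * ‖∏ i ∈ s, a i - ∏ i ∈ s, b i‖ :=
          (norm_add_le _ _).trans (add_le_add (norm_mul_le _ _) (norm_mul_le _ _))
      _ ≤ ‖a j - b j‖ * 1 + 1 * ∑ i ∈ s, ‖a i - b i‖ := by
          gcongr
          exacts [ha.1, ih ha.2 hb.2]
      _ = ‖a j - b j‖ + ∑ i ∈ s, ‖a i - b i‖ := by ring

theorem norm_exp_mul_I_sub_taylor_le {x : ℝ} (hx : |x| ≤ 1) :
    ‖Complex.exp (x * Complex.I) - (1 + x * Complex.I - x ^ 2 / 2)‖ ≤ |x| ^ 3 := by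
  have hnorm : ‖(x : ℂ) * Complex.I‖ = |x| := by simp
  have htaylor : ∑ m ∈ Finset.range 3, ((x : ℂ) * Complex.I) ^ m / m.factorial
      = 1 + x * Complex.I - x ^ 2 / 2 := by
    simp only [Finset.sum_range_succ, Finset.sum_range_zero, mul_pow, Complex.I_sq,
      Nat.factorial]
    push_cast
    ring
  have hbound := Complex.exp_bound (hnorm.trans_le hx) (n := 3) (by norm_num)
  rw [htaylor, hnorm] at hbound
  refine hbound.trans (mul_le_of_le_one_right (by positivity) ?_)
  norm_num [Nat.factorial]

variable {Ω : Type*} [MeasurableSpace Ω] {P : Measure Ω} [IsProbabilityMeasure P]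

theorem variance_le_sq_of_abs_le {Y : Ω → ℝ} {b : ℝ} (hY : AEMeasurable Y P)
    (hb : ∀ᵐ ω ∂P, |Y ω| ≤ b) : Var[Y; P] ≤ b ^ 2 := by
  have hsq : ∀ᵐ ω ∂P, Y ω ^ 2 ≤ b ^ 2 := by
    filter_upwards [hb] with ω hω using sq_le_sq' (abs_le.1 hω).1 (abs_le.1 hω).2
  calc Var[Y; P] ≤ ∫ ω, Y ω ^ 2 ∂P := variance_le_expectation_sq hY.aestronglyMeasurable
    _ ≤ ∫ _, b ^ 2 ∂P := integral_mono_of_nonneg (Eventually.of_forall fun ω => sq_nonneg _)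
        (integrable_const _) hsq
    _ = b ^ 2 := by simp

theorem norm_integral_exp_mul_I_sub_le {Y : Ω → ℝ} {b : ℝ} (hY : AEMeasurable Y P)
    (hb : ∀ᵐ ω ∂P, |Y ω| ≤ b) (hb1 : b ≤ 1) (h0 : ∫ ω, Y ω ∂P = 0) :
    ‖∫ ω, Complex.exp (Y ω * Complex.I) ∂P - ((1 - Var[Y; P] / 2 : ℝ) : ℂ)‖ ≤ b * Var[Y; P] := by
  have hL2 : MemLp Y 2 P := MemLp.of_bound hY.aestronglyMeasurable b hb
  have hexp : Integrable (fun ω => Complex.exp (Y ω * Complex.I)) P :=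
    Integrable.of_bound (C := 1) (by fun_prop)
      (Eventually.of_forall fun ω => (Complex.norm_exp_ofReal_mul_I _).le)
  have hmul : Integrable (fun ω => (Y ω : ℂ) * Complex.I) P :=
    (hL2.integrable (by norm_num)).ofReal.mul_const _
  have hlin : Integrable (fun ω => 1 + (Y ω : ℂ) * Complex.I) P := (integrable_const _).add hmul
  have hquad : Integrable (fun ω => (Y ω : ℂ) ^ 2 / 2) P := by
    simpa using (hL2.integrable_sq.ofReal (𝕜 := ℂ)).div_const 2
  have hpoly : ∫ ω, (1 + (Y ω : ℂ) * Complex.I - (Y ω : ℂ) ^ 2 / 2) ∂P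
      = ((1 - Var[Y; P] / 2 : ℝ) : ℂ) := by
    rw [integral_sub hlin hquad, integral_add (integrable_const _) hmul,
      integral_mul_const, integral_complex_ofReal, h0,
      integral_div, variance_of_integral_eq_zero hY h0]
    simp only [← Complex.ofReal_pow, integral_complex_ofReal]
    simp
  have htaylor : Integrable (fun ω => 1 + (Y ω : ℂ) * Complex.I - (Y ω : ℂ) ^ 2 / 2) P :=
    hlin.sub hquad
  rw [← hpoly, ← integral_sub hexp htaylor,
    variance_of_integral_eq_zero hY h0, ← integral_const_mul]
  refine norm_integral_le_of_norm_le (hL2.integrable_sq.const_mul _) ?_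
  filter_upwards [hb] with ω hω
  calc _ ≤ |Y ω| ^ 3 := norm_exp_mul_I_sub_taylor_le (hω.trans hb1)
    _ = |Y ω| * Y ω ^ 2 := by rw [← sq_abs (Y ω)]; ring
    _ ≤ b * Y ω ^ 2 := by gcongr

theorem norm_integral_exp_mul_I_sub_exp_le {Y : Ω → ℝ} {b : ℝ} (hY : AEMeasurable Y P)
    (hb : ∀ᵐ ω ∂P, |Y ω| ≤ b) (hb1 : b ≤ 1) (h0 : ∫ ω, Y ω ∂P = 0) :
    ‖∫ ω, Complex.exp (Y ω * Complex.I) ∂P - (Real.exp (-(Var[Y; P] / 2)) : ℝ)‖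
      ≤ 2 * (b * Var[Y; P]) := by
  obtain ⟨ω, hω⟩ := hb.exists
  have hb0 : 0 ≤ b := (abs_nonneg _).trans hω
  have hvar0 : 0 ≤ Var[Y; P] := variance_nonneg _ _
  have hvar : Var[Y; P] ≤ b := (variance_le_sq_of_abs_le hY hb).trans (by nlinarith)
  have hexp : ‖((1 - Var[Y; P] / 2 : ℝ) : ℂ) - (Real.exp (-(Var[Y; P] / 2)) : ℝ)‖
      ≤ b * Var[Y; P] := by
    rw [← Complex.ofReal_sub, Complex.norm_real, Real.norm_eq_abs, abs_sub_comm]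
    calc _ = |Real.exp (-(Var[Y; P] / 2)) - 1 - -(Var[Y; P] / 2)| := by congr 1; ring
      _ ≤ (-(Var[Y; P] / 2)) ^ 2 := Real.abs_exp_sub_one_sub_id_le (by
          rw [abs_neg, abs_of_nonneg (by positivity)]; linarith)
      _ ≤ b * Var[Y; P] := by nlinarith
  calc _ ≤ _ := norm_sub_le_norm_sub_add_norm_sub _ ((1 - Var[Y; P] / 2 : ℝ) : ℂ) _
    _ ≤ b * Var[Y; P] + b * Var[Y; P] :=
        add_le_add (norm_integral_exp_mul_I_sub_le hY hb hb1 h0) hexp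
    _ = 2 * (b * Var[Y; P]) := by ring

theorem norm_charFun_map_sub_exp_le {Y : Ω → ℝ} {b t : ℝ} (hY : AEMeasurable Y P)
    (hb : ∀ᵐ ω ∂P, |Y ω| ≤ b) (h0 : ∫ ω, Y ω ∂P = 0) (ht : |t| * b ≤ 1) :
    ‖charFun (P.map Y) t - (Real.exp (-(t ^ 2 * Var[Y; P] / 2)) : ℝ)‖
      ≤ 2 * (|t| * b * (t ^ 2 * Var[Y; P])) := by
  have hcf : charFun (P.map Y) t = ∫ ω, Complex.exp (↑(t * Y ω) * Complex.I) ∂P := by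
    rw [charFun_apply_real, integral_map hY (by fun_prop)]
    simp only [Complex.ofReal_mul]
  have htb : ∀ᵐ ω ∂P, |t * Y ω| ≤ |t| * b := by
    filter_upwards [hb] with ω hω
    rw [abs_mul]
    gcongr
  rw [hcf, ← variance_const_mul]
  exact norm_integral_exp_mul_I_sub_exp_le (hY.const_mul t) htb ht (by
    rw [integral_const_mul, h0, mul_zero])

theorem norm_charFun_map_sum_sub_exp_le {ι : Type*} [Fintype ι] {Y : ι → Ω → ℝ} {b t : ℝ}
    (hY : ∀ i, AEMeasurable (Y i) P) (hind : iIndepFun Y P) (hb : ∀ i, ∀ᵐ ω ∂P, |Y i ω| ≤ b)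
    (h0 : ∀ i, ∫ ω, Y i ω ∂P = 0) (ht : |t| * b ≤ 1) :
    ‖charFun (P.map fun ω => ∑ i, Y i ω) t - (Real.exp (-(t ^ 2 * (∑ i, Var[Y i; P]) / 2)) : ℝ)‖
      ≤ 2 * (|t| * b * (t ^ 2 * ∑ i, Var[Y i; P])) := by
  have hprod : ((Real.exp (-(t ^ 2 * (∑ i, Var[Y i; P]) / 2)) : ℝ) : ℂ)
      = ∏ i, ((Real.exp (-(t ^ 2 * Var[Y i; P] / 2)) : ℝ) : ℂ) := by
    rw [← Complex.ofReal_prod, ← Real.exp_sum, Finset.sum_neg_distrib, ← Finset.sum_div,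
      ← Finset.mul_sum]
  rw [hind.charFun_map_fun_sum_eq_prod hY, Finset.prod_apply, hprod]
  refine (norm_prod_sub_prod_le_sum _ (fun i _ => ?_) fun i _ => ?_).trans ?_
  · have := Measure.isProbabilityMeasure_map (hY i)
    exact norm_charFun_le_one _
  · rw [Complex.norm_real, Real.norm_eq_abs, Real.abs_exp, Real.exp_le_one_iff, neg_nonpos]
    have := variance_nonneg (Y i) P
    positivity
  · rw [Finset.mul_sum, Finset.mul_sum, Finset.mul_sum]
    exact Finset.sum_le_sum fun i _ => norm_charFun_map_sub_exp_le (hY i) (hb i) (h0 i) ht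

theorem tendstoInDistribution_gaussianReal_of_bounded {Ω : ℕ → Type*} {ι : ℕ → Type*}
    [∀ n, Fintype (ι n)] {mΩ : ∀ n, MeasurableSpace (Ω n)} {P : (n : ℕ) → Measure (Ω n)}
    [∀ n, IsProbabilityMeasure (P n)] {Y : (n : ℕ) → ι n → Ω n → ℝ} {b : ℝ}
    (hY : ∀ n i, AEMeasurable (Y n i) (P n)) (hind : ∀ n, iIndepFun (Y n) (P n))
    (hb : ∀ n i, ∀ᵐ ω ∂(P n), |Y n i ω| ≤ b) (h0 : ∀ n i, ∫ ω, Y n i ω ∂(P n) = 0)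
    (hvar : Tendsto (fun n => ∑ i, Var[Y n i; P n]) atTop atTop) :
    TendstoInDistribution (fun n ω => (√(∑ i, Var[Y n i; P n]))⁻¹ * ∑ i, Y n i ω)
      atTop (id : ℝ → ℝ) P (gaussianReal 0 1) := by
  have hsum : ∀ n, AEMeasurable (fun ω => ∑ i, Y n i ω) (P n) := fun n =>
    Finset.aemeasurable_fun_sum _ fun i _ => hY n i
  refine ⟨fun n => (hsum n).const_mul _, aemeasurable_id,
    ProbabilityMeasure.tendsto_iff_tendsto_charFun.2 fun t => ?_⟩
  set s : ℕ → ℝ := fun n => √(∑ i, Var[Y n i; P n])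
  have hs_top : Tendsto s atTop atTop := Real.tendsto_sqrt_atTop.comp hvar
  have hlim : charFun ((gaussianReal 0 1).map (id : ℝ → ℝ)) t = (Real.exp (-(t ^ 2 / 2)) : ℝ) := by
    rw [Measure.map_id, charFun_gaussianReal]
    push_cast
    congr 1
    simp
  have hbound : Tendsto (fun n => 2 * |t| * b * t ^ 2 * (s n)⁻¹) atTop (𝓝 0) := by
    simpa using (tendsto_inv_atTop_zero.comp hs_top).const_mul (2 * |t| * b * t ^ 2)
  simp only [ProbabilityMeasure.coe_mk]
  rw [hlim, tendsto_iff_norm_sub_tendsto_zero]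
  refine squeeze_zero' (Eventually.of_forall fun n => norm_nonneg _) ?_ hbound
  filter_upwards [hs_top.eventually_gt_atTop 0, hs_top.eventually_ge_atTop (|t| * b)] with n h0s hn
  have hsq : s n ^ 2 = ∑ i, Var[Y n i; P n] :=
    Real.sq_sqrt (Finset.sum_nonneg fun i _ => variance_nonneg _ _)
  have habs : |(s n)⁻¹ * t| = (s n)⁻¹ * |t| := by rw [abs_mul, abs_of_pos (inv_pos.2 h0s)]
  have hu : |(s n)⁻¹ * t| * b ≤ 1 := by rwa [habs, mul_assoc, inv_mul_le_one₀ h0s]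
  have h := norm_charFun_map_sum_sub_exp_le (hY n) (hind n) (hb n) (h0 n) hu
  rw [← hsq, habs, ← charFun_map_mul_comp (hsum n)] at h
  convert h using 1
  · congr 4
    field_simp
  · field_simp

end BoundedArrays

section DegenerateQuadraticForms

variable {ι Ω : Type*} [MeasurableSpace Ω] {P : Measure Ω}

/-- The quadratic form `∑ x i * x j` over the ordered pairs `i ≠ j` in `s`. Evaluated at independent
centred random variables it is a degenerate U-statistic, orthogonal to every linear form. -/
def offDiagSum (s : Finset ι) (x : ι → ℝ) : ℝ := (∑ i ∈ s, x i) ^ 2 - ∑ i ∈ s, x i ^ 2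

theorem offDiagSum_insert [DecidableEq ι] {s : Finset ι} {j : ι} (hj : j ∉ s) (x : ι → ℝ) :
    offDiagSum (insert j s) x = offDiagSum s x + 2 * (∑ i ∈ s, x i) * x j := by
  rw [offDiagSum, offDiagSum, Finset.sum_insert hj, Finset.sum_insert hj]
  ring

theorem memLp_two_mul_of_indepFun {U V : Ω → ℝ} (hUV : IndepFun U V P) (hU : MemLp U 2 P)
    (hV : MemLp V 2 P) : MemLp (fun ω => U ω * V ω) 2 P := by
  have hsq : Measurable fun x : ℝ => x ^ 2 := by fun_prop
  refine (memLp_two_iff_integrable_sq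
    (hU.aestronglyMeasurable.mul hV.aestronglyMeasurable)).2 ?_
  refine ((hUV.comp hsq hsq).integrable_mul hU.integrable_sq hV.integrable_sq).congr ?_
  exact Eventually.of_forall fun ω => (mul_pow (U ω) (V ω) 2).symm

theorem integral_add_mul_sq_of_indepFun [IsFiniteMeasure P] {U W ξ : Ω → ℝ}
    (hind : IndepFun (fun ω => (U ω, W ω)) ξ P)
    (hU : MemLp U 2 P) (hW : MemLp W 2 P) (hξ : MemLp ξ 2 P) (h0 : P[ξ] = 0) :
    ∫ ω, (U ω + W ω * ξ ω) ^ 2 ∂P = ∫ ω, U ω ^ 2 ∂P + (∫ ω, W ω ^ 2 ∂P) * ∫ ω, ξ ω ^ 2 ∂P := by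
  have hindCross : IndepFun (fun ω => U ω * W ω) ξ P :=
    hind.comp (measurable_fst.mul measurable_snd) measurable_id
  have hindSq : IndepFun (fun ω => W ω ^ 2) (fun ω => ξ ω ^ 2) P :=
    hind.comp (measurable_snd.pow_const 2) (measurable_id.pow_const 2)
  have hcross : ∫ ω, U ω * W ω * ξ ω ∂P = 0 := by
    rw [hindCross.integral_fun_mul_eq_mul_integral (hU.integrable_mul hW).aestronglyMeasurable
      hξ.aestronglyMeasurable, h0, mul_zero]
  calc ∫ ω, (U ω + W ω * ξ ω) ^ 2 ∂P
      = ∫ ω, (U ω ^ 2 + 2 * (U ω * W ω * ξ ω) + W ω ^ 2 * ξ ω ^ 2) ∂P := by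
        congr with ω
        ring
    _ = ∫ ω, U ω ^ 2 ∂P + 2 * ∫ ω, U ω * W ω * ξ ω ∂P + ∫ ω, W ω ^ 2 * ξ ω ^ 2 ∂P := by
        have hiCross : Integrable (fun ω => 2 * (U ω * W ω * ξ ω)) P :=
          (hindCross.integrable_mul (hU.integrable_mul hW) (hξ.integrable one_le_two)).const_mul 2
        have hiSq : Integrable (fun ω => W ω ^ 2 * ξ ω ^ 2) P :=
          hindSq.integrable_mul hW.integrable_sq hξ.integrable_sq
        have hiSum : Integrable (fun ω => U ω ^ 2 + 2 * (U ω * W ω * ξ ω)) P :=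
          hU.integrable_sq.add hiCross
        rw [integral_add hiSum hiSq, integral_add hU.integrable_sq hiCross, integral_const_mul]
    _ = ∫ ω, U ω ^ 2 ∂P + (∫ ω, W ω ^ 2 ∂P) * ∫ ω, ξ ω ^ 2 ∂P := by
        rw [hcross, hindSq.integral_fun_mul_eq_mul_integral hW.integrable_sq.aestronglyMeasurable
          hξ.integrable_sq.aestronglyMeasurable, mul_zero, add_zero]

variable {ξ : ι → Ω → ℝ}

theorem indepFun_sum_offDiagSum_of_notMem (hind : iIndepFun ξ P) (hm : ∀ i, AEMeasurable (ξ i) P)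
    {s : Finset ι} {j : ι} (hj : j ∉ s) :
    IndepFun (fun ω => (∑ i ∈ s, ξ i ω, offDiagSum s fun i => ξ i ω)) (ξ j) P := by
  have hφ : Measurable fun y : s → ℝ => (∑ i, y i, offDiagSum Finset.univ y) := by
    unfold offDiagSum
    fun_prop
  have hψ : Measurable fun y : ({j} : Finset ι) → ℝ => y ⟨j, Finset.mem_singleton_self j⟩ :=
    measurable_pi_apply _
  convert (hind.indepFun_finset₀ s {j} (Finset.disjoint_singleton_right.2 hj) hm).comp hφ hψ
    using 2 with ω
  · simp only [Function.comp, offDiagSum, Finset.sum_coe_sort s fun i => ξ i ω,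
      Finset.sum_coe_sort s fun i => ξ i ω ^ 2]
  · rfl

theorem memLp_offDiagSum [IsFiniteMeasure P] (hind : iIndepFun ξ P)
    (hL2 : ∀ i, MemLp (ξ i) 2 P) (s : Finset ι) :
    MemLp (fun ω => offDiagSum s fun i => ξ i ω) 2 P := by
  classical
  induction s using Finset.induction_on with
  | empty => simp [offDiagSum]
  | insert j s hj ih =>
    simp only [offDiagSum_insert hj]
    have hprod : MemLp (fun ω => (∑ i ∈ s, ξ i ω) * ξ j ω) 2 P := memLp_two_mul_of_indepFun
      ((indepFun_sum_offDiagSum_of_notMem hind (fun i => (hL2 i).aemeasurable) hj).comp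
        measurable_fst measurable_id)
      (memLp_finsetSum s fun i _ => hL2 i) (hL2 j)
    simp only [mul_assoc]
    exact ih.add (hprod.const_mul 2)

variable [IsProbabilityMeasure P]

theorem integral_offDiagSum (hind : iIndepFun ξ P) (hL2 : ∀ i, MemLp (ξ i) 2 P)
    (h0 : ∀ i, P[ξ i] = 0) (s : Finset ι) : ∫ ω, offDiagSum s (fun i => ξ i ω) ∂P = 0 := by
  classical
  induction s using Finset.induction_on with
  | empty => simp [offDiagSum]
  | insert j s hj ih =>
    have hS : MemLp (fun ω => ∑ i ∈ s, ξ i ω) 2 P := memLp_finsetSum s fun i _ => hL2 i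
    have hSξ : IndepFun (fun ω => ∑ i ∈ s, ξ i ω) (ξ j) P :=
      (indepFun_sum_offDiagSum_of_notMem hind (fun i => (hL2 i).aemeasurable) hj).comp
        measurable_fst measurable_id
    have hcross : Integrable (fun ω => 2 * ((∑ i ∈ s, ξ i ω) * ξ j ω)) P :=
      (hS.integrable_mul (hL2 j)).const_mul 2
    simp only [offDiagSum_insert hj, mul_assoc]
    rw [integral_add ((memLp_offDiagSum hind hL2 s).integrable one_le_two) hcross, ih,
      integral_const_mul, hSξ.integral_fun_mul_eq_mul_integral hS.aestronglyMeasurable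
        (hL2 j).aestronglyMeasurable, h0, mul_zero, mul_zero, add_zero]

theorem integral_const_add_mul_sum_sq (hind : iIndepFun ξ P)
    (hL2 : ∀ i, MemLp (ξ i) 2 P) (h0 : ∀ i, P[ξ i] = 0) (a b : ℝ) (s : Finset ι) :
    ∫ ω, (a + b * ∑ i ∈ s, ξ i ω) ^ 2 ∂P = a ^ 2 + b ^ 2 * ∑ i ∈ s, ∫ ω, ξ i ω ^ 2 ∂P := by
  classical
  induction s using Finset.induction_on with
  | empty => simp
  | insert j s hj ih =>
    have hstep := integral_add_mul_sq_of_indepFun (ξ := ξ j) (U := fun ω => a + b * ∑ i ∈ s, ξ i ω)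
      (W := fun _ => b)
      ((indepFun_sum_offDiagSum_of_notMem hind (fun i => (hL2 i).aemeasurable) hj).comp
        (φ := fun y : ℝ × ℝ => (a + b * y.1, b)) (by fun_prop) measurable_id)
      ((memLp_const a).add ((memLp_finsetSum s fun i _ => hL2 i).const_mul b))
      (memLp_const b) (hL2 j) (h0 j)
    simp only [Finset.sum_insert hj]
    rw [ih] at hstep
    convert hstep using 1
    · congr with ω
      ring
    · simp only [integral_const, probReal_univ, one_smul]
      ring

theorem integral_mul_sum_add_mul_offDiagSum_sq (hind : iIndepFun ξ P)
    (hL2 : ∀ i, MemLp (ξ i) 2 P) (h0 : ∀ i, P[ξ i] = 0) (a b : ℝ)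
    (s : Finset ι) :
    ∫ ω, (a * ∑ i ∈ s, ξ i ω + b * offDiagSum s fun i => ξ i ω) ^ 2 ∂P
      = a ^ 2 * ∑ i ∈ s, ∫ ω, ξ i ω ^ 2 ∂P
        + 2 * b ^ 2 * offDiagSum s fun i => ∫ ω, ξ i ω ^ 2 ∂P := by
  classical
  induction s using Finset.induction_on with
  | empty => simp [offDiagSum]
  | insert j s hj ih =>
    have hS : MemLp (fun ω => ∑ i ∈ s, ξ i ω) 2 P := memLp_finsetSum s fun i _ => hL2 i
    have hstep := integral_add_mul_sq_of_indepFun (ξ := ξ j)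
      (U := fun ω => a * ∑ i ∈ s, ξ i ω + b * offDiagSum s fun i => ξ i ω)
      (W := fun ω => a + 2 * b * ∑ i ∈ s, ξ i ω)
      ((indepFun_sum_offDiagSum_of_notMem hind (fun i => (hL2 i).aemeasurable) hj).comp
        (φ := fun y : ℝ × ℝ => (a * y.1 + b * y.2, a + 2 * b * y.1)) (by fun_prop) measurable_id)
      ((hS.const_mul a).add ((memLp_offDiagSum hind hL2 s).const_mul b))
      ((memLp_const a).add (hS.const_mul (2 * b))) (hL2 j) (h0 j)
    rw [ih, integral_const_add_mul_sum_sq hind hL2 h0] at hstep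
    simp only [Finset.sum_insert hj, offDiagSum_insert hj]
    convert hstep using 1
    · congr with ω
      ring
    · ring

end DegenerateQuadraticForms

section GroupStatistics

variable {ι : Type*} {J : Finset ι} {x : ι → ℝ} {q r : ℝ}

/-- The number of points `x k`, `k ∈ J`, which are at most `q`. -/
noncomputable def groupCount (J : Finset ι) (x : ι → ℝ) (q : ℝ) : ℝ :=
  ∑ k ∈ J, if x k ≤ q then (1 : ℝ) else 0

/-- The contribution `N (m - N) / (m - 1)` of a group of size `m` to the variance estimator, where
`N` of its points are at most `q`. -/
noncomputable def groupStat (J : Finset ι) (x : ι → ℝ) (q : ℝ) : ℝ :=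
  ((J.card : ℝ) - 1)⁻¹ * (groupCount J x q * (J.card - groupCount J x q))

theorem groupCount_nonneg : 0 ≤ groupCount J x q :=
  Finset.sum_nonneg fun _ _ => by split_ifs <;> simp

theorem groupCount_le_card : groupCount J x q ≤ J.card := by
  rw [Finset.card_eq_sum_ones]
  push_cast
  exact Finset.sum_le_sum fun _ _ => by split_ifs <;> simp

theorem groupCount_mono (hqr : q ≤ r) : groupCount J x q ≤ groupCount J x r := by
  refine Finset.sum_le_sum fun i _ => ?_
  by_cases h : x i ≤ q
  · simp [h, h.trans hqr]
  · simp only [h, if_false]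
    split_ifs <;> simp

theorem sum_sum_ite_le_and_lt :
    ∑ k ∈ J, ∑ l ∈ J, (if x k ≤ q ∧ q < x l then (1 : ℝ) else 0)
      = groupCount J x q * (J.card - groupCount J x q) := by
  have hcompl : (J.card : ℝ) - groupCount J x q = ∑ l ∈ J, if q < x l then (1 : ℝ) else 0 := by
    rw [groupCount, Finset.cast_card, ← Finset.sum_sub_distrib]
    refine Finset.sum_congr rfl fun l _ => ?_
    by_cases hl : x l ≤ q
    · simp [hl, not_lt.2 hl]
    · simp [hl, not_le.1 hl]
  rw [hcompl, groupCount, Finset.sum_mul_sum]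
  refine Finset.sum_congr rfl fun k _ => Finset.sum_congr rfl fun l _ => ?_
  by_cases hk : x k ≤ q <;> simp [hk]

theorem groupStat_nonneg (hJ : 2 ≤ J.card) : 0 ≤ groupStat J x q := by
  have hm : (2 : ℝ) ≤ J.card := by exact_mod_cast hJ
  exact mul_nonneg (inv_nonneg.2 (by linarith))
    (mul_nonneg groupCount_nonneg (sub_nonneg.2 groupCount_le_card))

theorem groupStat_le (hJ : 2 ≤ J.card) : groupStat J x q ≤ J.card / 2 := by
  have hm : (2 : ℝ) ≤ J.card := by exact_mod_cast hJ
  rw [groupStat, inv_mul_le_iff₀ (by linarith)]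
  nlinarith [sq_nonneg ((J.card : ℝ) - 2 * groupCount J x q)]

theorem abs_groupStat_sub_le (hJ : 2 ≤ J.card) (hqr : q ≤ r) :
    |groupStat J x r - groupStat J x q| ≤ 2 * (groupCount J x r - groupCount J x q) := by
  have hm : (2 : ℝ) ≤ J.card := by exact_mod_cast hJ
  have hpos : (0 : ℝ) < J.card - 1 := by linarith
  have hdiff : groupStat J x r - groupStat J x q = ((J.card : ℝ) - 1)⁻¹ *
      ((groupCount J x r - groupCount J x q) *
        (J.card - groupCount J x q - groupCount J x r)) := by
    unfold groupStat
    ring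
  have hfactor : |(J.card : ℝ) - groupCount J x q - groupCount J x r| ≤ 2 * (J.card - 1) := by
    have hq0 : 0 ≤ groupCount J x q := groupCount_nonneg
    have hr0 : 0 ≤ groupCount J x r := groupCount_nonneg
    have hq1 : groupCount J x q ≤ J.card := groupCount_le_card
    have hr1 : groupCount J x r ≤ J.card := groupCount_le_card
    rw [abs_le]
    constructor <;> linarith
  have hmono : 0 ≤ groupCount J x r - groupCount J x q := sub_nonneg.2 (groupCount_mono hqr)
  rw [hdiff, abs_mul, abs_of_pos (inv_pos.2 hpos), inv_mul_le_iff₀ hpos, abs_mul,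
    abs_of_nonneg hmono]
  linarith [mul_le_mul_of_nonneg_left hfactor hmono]

theorem groupStat_eq_add_mul_sum_add_mul_offDiagSum (hJ : J.card ≠ 1) {p : ℝ} {y : ι → ℝ}
    (hy : ∀ i ∈ J, y i = (if x i ≤ q then 1 else 0) - p) :
    groupStat J x q = J.card * (p * (1 - p))
      + ((1 - 2 * p) * ∑ i ∈ J, y i + -((J.card : ℝ) - 1)⁻¹ * offDiagSum J y) := by
  have hm : (J.card : ℝ) - 1 ≠ 0 := sub_ne_zero.2 (by exact_mod_cast hJ)
  have hsum : ∑ i ∈ J, y i = groupCount J x q - J.card * p := by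
    simp [Finset.sum_congr rfl hy, groupCount, Finset.sum_sub_distrib]
  have hsumsq : ∑ i ∈ J, y i ^ 2 = (1 - 2 * p) * groupCount J x q + J.card * p ^ 2 := by
    rw [groupCount, Finset.mul_sum, ← nsmul_eq_mul, ← Finset.sum_const, ← Finset.sum_add_distrib]
    refine Finset.sum_congr rfl fun i hi => ?_
    rw [hy i hi]
    split_ifs <;> ring
  rw [offDiagSum, hsum, hsumsq, groupStat]
  field_simp
  ring

/-- The sum of the group statistics over a partition: `n` times the variance estimator, with the
empirical quantile replaced by an arbitrary point `q`. -/
noncomputable def pooledStat [DecidableEq ι] {s : Finset ι} (I : Finpartition s) (x : ι → ℝ)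
    (q : ℝ) : ℝ :=
  ∑ J ∈ I.parts, groupStat J x q

variable [DecidableEq ι] {s : Finset ι} {I : Finpartition s}

theorem sum_parts_sum {M : Type*} [AddCommMonoid M] (I : Finpartition s) (f : ι → M) :
    ∑ J ∈ I.parts, ∑ i ∈ J, f i = ∑ i ∈ s, f i := by
  conv_rhs => rw [← I.biUnion_parts]
  exact (Finset.sum_biUnion I.disjoint).symm

theorem pooledStat_le (hI : ∀ J ∈ I.parts, 2 ≤ J.card) : pooledStat I x q ≤ s.card / 2 := by
  refine (Finset.sum_le_sum fun J hJ => groupStat_le (hI J hJ)).trans_eq ?_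
  rw [← Finset.sum_div, ← I.sum_card_parts, Nat.cast_sum]

theorem abs_pooledStat_sub_le (hI : ∀ J ∈ I.parts, 2 ≤ J.card) (q r : ℝ) :
    |pooledStat I x r - pooledStat I x q| ≤ 2 * |groupCount s x r - groupCount s x q| := by
  wlog hqr : q ≤ r generalizing q r
  · simpa only [abs_sub_comm] using this r q (le_of_not_ge hqr)
  calc |pooledStat I x r - pooledStat I x q|
      ≤ ∑ J ∈ I.parts, 2 * (groupCount J x r - groupCount J x q) := by
        rw [pooledStat, pooledStat, ← Finset.sum_sub_distrib]
        exact (Finset.abs_sum_le_sum_abs _ _).trans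
          (Finset.sum_le_sum fun J hJ => abs_groupStat_sub_le (hI J hJ) hqr)
    _ = 2 * (groupCount s x r - groupCount s x q) := by
        rw [← Finset.mul_sum, Finset.sum_sub_distrib]
        simp only [groupCount, sum_parts_sum]
    _ ≤ 2 * |groupCount s x r - groupCount s x q| := by
        gcongr
        exact le_abs_self _

end GroupStatistics

section GroupMoments

variable {ι Ω : Type*} [MeasurableSpace Ω] {P : Measure Ω} {Y : Ω → ℝ} {X : ι → Ω → ℝ} {q : ℝ}

/-- The indicator of the event `Y ≤ q`, minus the probability of that event. -/
noncomputable def centeredInd (P : Measure Ω) (Y : Ω → ℝ) (q : ℝ) (ω : Ω) : ℝ :=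
  (if Y ω ≤ q then 1 else 0) - distFun P Y q

/-- The variance `∑ᵢ Fᵢ(q) (1 - Fᵢ(q))` of the number of `i ∈ s` with `X i ≤ q`, for independent
`X i`. -/
noncomputable def sumVar (P : Measure Ω) (X : ι → Ω → ℝ) (s : Finset ι) (q : ℝ) : ℝ :=
  ∑ i ∈ s, distFun P (X i) q * (1 - distFun P (X i) q)

theorem measurable_ite_le (hY : Measurable Y) (q : ℝ) :
    Measurable fun ω => if Y ω ≤ q then (1 : ℝ) else 0 :=
  Measurable.ite (measurableSet_le hY measurable_const) measurable_const measurable_const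

theorem measurable_centeredInd (hY : Measurable Y) : Measurable (centeredInd P Y q) :=
  (measurable_ite_le hY q).sub_const _

theorem abs_centeredInd_le (ω : Ω) : |centeredInd P Y q ω| ≤ 1 := by
  have h0 : 0 ≤ distFun P Y q := cdf_nonneg _ _
  have h1 : distFun P Y q ≤ 1 := cdf_le_one _ _
  rw [centeredInd, abs_le]
  split_ifs <;> constructor <;> linarith

theorem measurable_groupCount (hX : ∀ i, Measurable (X i)) (J : Finset ι) (q : ℝ) :
    Measurable fun ω => groupCount J (fun i => X i ω) q :=
  Finset.measurable_sum _ fun i _ => measurable_ite_le (hX i) q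

theorem measurable_groupStat (hX : ∀ i, Measurable (X i)) (J : Finset ι) (q : ℝ) :
    Measurable fun ω => groupStat J (fun i => X i ω) q := by
  have := measurable_groupCount hX J q
  unfold groupStat
  fun_prop

theorem indepFun_groupStat_of_disjoint (hind : iIndepFun X P) (hX : ∀ i, Measurable (X i))
    {J K : Finset ι} (hJK : Disjoint J K) (q : ℝ) :
    IndepFun (fun ω => groupStat J (fun i => X i ω) q) (fun ω => groupStat K (fun i => X i ω) q)
      P := by
  have hrestrict : ∀ L : Finset ι, (fun ω => groupStat L (fun i => X i ω) q)
      = (fun y : L → ℝ => groupStat Finset.univ y q) ∘ fun ω (i : L) => X i ω := fun L => by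
    ext ω
    simp only [groupStat, groupCount, Function.comp, Finset.card_univ, Fintype.card_coe,
      Finset.sum_coe_sort L fun k => if X k ω ≤ q then (1 : ℝ) else 0]
  have hmeas : ∀ L : Finset ι, Measurable fun y : L → ℝ => groupStat Finset.univ y q :=
    fun L => measurable_groupStat measurable_pi_apply _ q
  rw [hrestrict J, hrestrict K]
  exact (hind.indepFun_finset J K hJK hX).comp (hmeas J) (hmeas K)

theorem iIndepFun_centeredInd (hind : iIndepFun X P) (q : ℝ) :
    iIndepFun (fun i => centeredInd P (X i) q) P :=
  hind.comp (fun i x => (if x ≤ q then (1 : ℝ) else 0) - distFun P (X i) q)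
    fun _ => (measurable_ite_le measurable_id q).sub_const _

theorem groupStat_eq_centeredInd {J : Finset ι} (hJ : J.card ≠ 1) {p : ℝ}
    (hp : ∀ i ∈ J, distFun P (X i) q = p) (ω : Ω) :
    groupStat J (fun i => X i ω) q = J.card * (p * (1 - p))
      + ((1 - 2 * p) * ∑ i ∈ J, centeredInd P (X i) q ω
        + -((J.card : ℝ) - 1)⁻¹ * offDiagSum J fun i => centeredInd P (X i) q ω) :=
  groupStat_eq_add_mul_sum_add_mul_offDiagSum hJ fun i hi => by rw [centeredInd, hp i hi]

/-- The grouping assumption: every part of `I` has at least two elements, and the `X i` with `i` in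
the same part have the same distribution function. -/
structure IsGrouping [DecidableEq ι] {s : Finset ι} (P : Measure Ω) (X : ι → Ω → ℝ)
    (I : Finpartition s) : Prop where
  two_le_card : ∀ J ∈ I.parts, 2 ≤ J.card
  distFun_eq : ∀ J ∈ I.parts, ∀ i ∈ J, ∀ j ∈ J, distFun P (X i) = distFun P (X j)

theorem IsGrouping.exists_forall_distFun_eq [DecidableEq ι] {s : Finset ι} {I : Finpartition s}
    (hI : IsGrouping P X I) {J : Finset ι} (hJ : J ∈ I.parts) (q : ℝ) :
    ∃ p, (∀ i ∈ J, distFun P (X i) q = p) ∧ sumVar P X J q = J.card * (p * (1 - p)) := by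
  obtain ⟨j, hj⟩ := I.nonempty_of_mem_parts hJ
  have hp : ∀ i ∈ J, distFun P (X i) q = distFun P (X j) q :=
    fun i hi => congrFun (hI.distFun_eq J hJ i hi j hj) q
  refine ⟨distFun P (X j) q, hp, ?_⟩
  rw [sumVar, Finset.sum_congr rfl fun i hi => by rw [hp i hi], Finset.sum_const, nsmul_eq_mul]

variable [IsProbabilityMeasure P]

theorem integral_ite_le (hY : Measurable Y) (q : ℝ) :
    ∫ ω, (if Y ω ≤ q then (1 : ℝ) else 0) ∂P = distFun P Y q := by
  have := Measure.isProbabilityMeasure_map (μ := P) hY.aemeasurable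
  rw [distFun, cdf_eq_real, map_measureReal_apply hY measurableSet_Iic,
    ← integral_indicator_one (hY measurableSet_Iic)]
  rfl

theorem integrable_ite_le (hY : Measurable Y) (q : ℝ) :
    Integrable (fun ω => if Y ω ≤ q then (1 : ℝ) else 0) P :=
  Integrable.of_bound (C := 1) (measurable_ite_le hY q).aestronglyMeasurable
    (Eventually.of_forall fun ω => by split_ifs <;> simp)

theorem memLp_centeredInd (hY : Measurable Y) : MemLp (centeredInd P Y q) 2 P :=
  MemLp.of_bound (measurable_centeredInd hY).aestronglyMeasurable 1
    (Eventually.of_forall abs_centeredInd_le)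

theorem integral_centeredInd (hY : Measurable Y) : ∫ ω, centeredInd P Y q ω ∂P = 0 := by
  unfold centeredInd
  rw [integral_sub (integrable_ite_le hY q) (integrable_const _), integral_ite_le hY]
  simp

theorem integral_centeredInd_sq (hY : Measurable Y) :
    ∫ ω, centeredInd P Y q ω ^ 2 ∂P = distFun P Y q * (1 - distFun P Y q) := by
  have hsq : ∀ ω, centeredInd P Y q ω ^ 2
      = (1 - 2 * distFun P Y q) * (if Y ω ≤ q then (1 : ℝ) else 0) + distFun P Y q ^ 2 :=
    fun ω => by
      unfold centeredInd
      split_ifs <;> ring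
  simp only [hsq]
  rw [integral_add ((integrable_ite_le hY q).const_mul _) (integrable_const _),
    integral_const_mul, integral_ite_le hY, integral_const, probReal_univ, one_smul]
  ring

theorem variance_centeredInd (hY : Measurable Y) :
    Var[centeredInd P Y q; P] = distFun P Y q * (1 - distFun P Y q) := by
  rw [variance_of_integral_eq_zero (measurable_centeredInd hY).aemeasurable
    (integral_centeredInd hY), integral_centeredInd_sq hY]

theorem memLp_groupStat (hX : ∀ i, Measurable (X i)) {J : Finset ι} (hJ : 2 ≤ J.card) :
    MemLp (fun ω => groupStat J (fun i => X i ω) q) 2 P :=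
  MemLp.of_bound (measurable_groupStat hX J q).aestronglyMeasurable (J.card / 2)
    (Eventually.of_forall fun _ =>
      (Real.norm_of_nonneg (groupStat_nonneg hJ)).trans_le (groupStat_le hJ))

theorem integral_groupStat (hX : ∀ i, Measurable (X i)) (hind : iIndepFun X P) {J : Finset ι}
    (hJ : J.card ≠ 1) {p : ℝ} (hp : ∀ i ∈ J, distFun P (X i) q = p) :
    ∫ ω, groupStat J (fun i => X i ω) q ∂P = J.card * (p * (1 - p)) := by
  have hL2 : ∀ i, MemLp (centeredInd P (X i) q) 2 P := fun i => memLp_centeredInd (hX i)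
  have h0 : ∀ i, ∫ ω, centeredInd P (X i) q ω ∂P = 0 := fun i => integral_centeredInd (hX i)
  have hindC := iIndepFun_centeredInd hind q
  have hlin : Integrable (fun ω => (1 - 2 * p) * ∑ i ∈ J, centeredInd P (X i) q ω) P :=
    ((memLp_finsetSum J fun i _ => hL2 i).integrable one_le_two).const_mul _
  have hoff : Integrable (fun ω => -((J.card : ℝ) - 1)⁻¹ *
      offDiagSum J fun i => centeredInd P (X i) q ω) P :=
    ((memLp_offDiagSum hindC hL2 J).integrable one_le_two).const_mul _
  have hsum : Integrable (fun ω => (1 - 2 * p) * ∑ i ∈ J, centeredInd P (X i) q ω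
      + -((J.card : ℝ) - 1)⁻¹ * offDiagSum J fun i => centeredInd P (X i) q ω) P := hlin.add hoff
  simp only [groupStat_eq_centeredInd hJ hp]
  rw [integral_add (integrable_const _) hsum, integral_add hlin hoff,
    integral_const_mul (1 - 2 * p), integral_const_mul (-((J.card : ℝ) - 1)⁻¹),
    integral_finsetSum J fun i _ => (hL2 i).integrable one_le_two,
    integral_offDiagSum hindC hL2 h0]
  simp [h0]

theorem variance_groupStat (hX : ∀ i, Measurable (X i)) (hind : iIndepFun X P) {J : Finset ι}
    (hJ : J.card ≠ 1) {p : ℝ} (hp : ∀ i ∈ J, distFun P (X i) q = p) :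
    Var[fun ω => groupStat J (fun i => X i ω) q; P]
      = (1 - 2 * p) ^ 2 * (J.card * (p * (1 - p)))
        + 2 * (J.card * (p * (1 - p)) ^ 2) / (J.card - 1) := by
  have hm : (J.card : ℝ) - 1 ≠ 0 := sub_ne_zero.2 (by exact_mod_cast hJ)
  have hsq : ∀ i ∈ J, ∫ ω, centeredInd P (X i) q ω ^ 2 ∂P = p * (1 - p) := fun i hi => by
    rw [integral_centeredInd_sq (hX i), hp i hi]
  have hoff : (offDiagSum J fun i => ∫ ω, centeredInd P (X i) q ω ^ 2 ∂P)
      = (J.card * (p * (1 - p))) ^ 2 - J.card * (p * (1 - p)) ^ 2 := by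
    rw [offDiagSum, Finset.sum_congr rfl hsq,
      Finset.sum_congr rfl fun i hi => congrArg (· ^ 2) (hsq i hi)]
    simp only [Finset.sum_const, nsmul_eq_mul]
  rw [variance_eq_integral (measurable_groupStat hX J q).aemeasurable,
    integral_groupStat hX hind hJ hp]
  simp only [groupStat_eq_centeredInd hJ hp, add_sub_cancel_left]
  rw [integral_mul_sum_add_mul_offDiagSum_sq (iIndepFun_centeredInd hind q)
    (fun i => memLp_centeredInd (hX i)) (fun i => integral_centeredInd (hX i)), hoff,
    Finset.sum_congr rfl hsq, Finset.sum_const, nsmul_eq_mul]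
  field_simp

theorem variance_groupStat_le (hX : ∀ i, Measurable (X i)) (hind : iIndepFun X P) {J : Finset ι}
    (hJ : 2 ≤ J.card) {p : ℝ} (hp : ∀ i ∈ J, distFun P (X i) q = p) :
    Var[fun ω => groupStat J (fun i => X i ω) q; P] ≤ J.card * (p * (1 - p)) := by
  have hm : (2 : ℝ) ≤ J.card := by exact_mod_cast hJ
  have hdiv : 2 * (J.card * (p * (1 - p)) ^ 2) / ((J.card : ℝ) - 1)
      ≤ 2 * (J.card * (p * (1 - p)) ^ 2) := div_le_self (by positivity) (by linarith)
  rw [variance_groupStat hX hind (by lia) hp]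
  nlinarith [mul_nonneg (Nat.cast_nonneg (α := ℝ) J.card) (sq_nonneg (p * (1 - p)))]

section Pooled

variable [DecidableEq ι] {s : Finset ι} {I : Finpartition s}

theorem memLp_pooledStat (hX : ∀ i, Measurable (X i)) (hI : ∀ J ∈ I.parts, 2 ≤ J.card) :
    MemLp (fun ω => pooledStat I (fun i => X i ω) q) 2 P :=
  memLp_finsetSum _ fun J hJ => memLp_groupStat hX (hI J hJ)

theorem IsGrouping.integral_pooledStat (hI : IsGrouping P X I) (hX : ∀ i, Measurable (X i))
    (hind : iIndepFun X P) : ∫ ω, pooledStat I (fun i => X i ω) q ∂P = sumVar P X s q := by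
  unfold pooledStat
  rw [integral_finsetSum _ fun J hJ =>
    (memLp_groupStat hX (hI.two_le_card J hJ)).integrable one_le_two, sumVar, ← sum_parts_sum I]
  refine Finset.sum_congr rfl fun J hJ => ?_
  obtain ⟨p, hp, hsum⟩ := hI.exists_forall_distFun_eq hJ q
  have hcard := hI.two_le_card J hJ
  exact (integral_groupStat hX hind (by lia) hp).trans hsum.symm

theorem IsGrouping.variance_pooledStat_le (hI : IsGrouping P X I) (hX : ∀ i, Measurable (X i))
    (hind : iIndepFun X P) :
    Var[fun ω => pooledStat I (fun i => X i ω) q; P] ≤ sumVar P X s q := by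
  have hsum : (fun ω => pooledStat I (fun i => X i ω) q)
      = ∑ J ∈ I.parts, fun ω => groupStat J (fun i => X i ω) q := by
    ext ω
    simp [pooledStat]
  rw [hsum, IndepFun.variance_sum (fun J hJ => memLp_groupStat hX (hI.two_le_card J hJ))
    fun J hJ K hK hJK => indepFun_groupStat_of_disjoint hind hX (I.disjoint hJ hK hJK) q,
    sumVar, ← sum_parts_sum I]
  refine Finset.sum_le_sum fun J hJ => ?_
  obtain ⟨p, hp, hsum⟩ := hI.exists_forall_distFun_eq hJ q
  exact (variance_groupStat_le hX hind (hI.two_le_card J hJ) hp).trans_eq hsum.symm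

end Pooled

section Tails

variable {s : Finset ι} {c : ℝ}

theorem measureReal_ge_le_variance_div_sq (hY : MemLp Y 2 P) (hc : 0 < c) :
    P.real {ω | c ≤ |Y ω - ∫ ω, Y ω ∂P|} ≤ Var[Y; P] / c ^ 2 :=
  ENNReal.toReal_le_of_le_ofReal (div_nonneg (variance_nonneg _ _) (sq_nonneg _))
    (meas_ge_le_variance_div_sq hY hc)

theorem variance_sum_centeredInd (hX : ∀ i, Measurable (X i)) (hind : iIndepFun X P)
    (s : Finset ι) (q : ℝ) :
    Var[fun ω => ∑ i ∈ s, centeredInd P (X i) q ω; P] = sumVar P X s q := by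
  have hsum : (fun ω => ∑ i ∈ s, centeredInd P (X i) q ω)
      = ∑ i ∈ s, centeredInd P (X i) q := by
    ext ω
    simp
  rw [hsum, IndepFun.variance_sum (fun i _ => memLp_centeredInd (hX i)) fun i _ j _ hij =>
    (iIndepFun_centeredInd hind q).indepFun hij]
  exact Finset.sum_congr rfl fun i _ => variance_centeredInd (hX i)

theorem measureReal_sum_centeredInd_ge_le (hX : ∀ i, Measurable (X i)) (hind : iIndepFun X P)
    (hc : 0 < c) :
    P.real {ω | c ≤ |∑ i ∈ s, centeredInd P (X i) q ω|} ≤ sumVar P X s q / c ^ 2 := by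
  have hmean : ∫ ω, ∑ i ∈ s, centeredInd P (X i) q ω ∂P = 0 := by
    rw [integral_finsetSum _ fun i _ => (memLp_centeredInd (hX i)).integrable one_le_two]
    exact Finset.sum_eq_zero fun i _ => integral_centeredInd (hX i)
  simpa only [hmean, sub_zero, variance_sum_centeredInd hX hind] using
    measureReal_ge_le_variance_div_sq
      (memLp_finsetSum s fun i _ => memLp_centeredInd (P := P) (q := q) (hX i)) hc

theorem IsGrouping.measureReal_pooledStat_ge_le [DecidableEq ι] {I : Finpartition s}
    (hI : IsGrouping P X I) (hX : ∀ i, Measurable (X i)) (hind : iIndepFun X P) (hc : 0 < c) :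
    P.real {ω | c ≤ |pooledStat I (fun i => X i ω) q - sumVar P X s q|}
      ≤ sumVar P X s q / c ^ 2 := by
  have h := measureReal_ge_le_variance_div_sq
    (memLp_pooledStat (P := P) (q := q) hX hI.two_le_card) hc
  rw [hI.integral_pooledStat hX hind] at h
  exact h.trans (by gcongr; exact hI.variance_pooledStat_le hX hind)

end Tails

end GroupMoments

section Quantiles

theorem quantile_le_iff {F : ℝ → ℝ} {u : ℝ} (hF : Monotone F)
    (hrc : ∀ x, ContinuousWithinAt F (Set.Ici x) x) (hlow : ∃ x, F x < u) (hup : ∃ x, u ≤ F x)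
    {t : ℝ} : quantile F u ≤ t ↔ u ≤ F t := by
  have hbdd : BddBelow {x | u ≤ F x} := by
    obtain ⟨y, hy⟩ := hlow
    exact ⟨y, fun x hx => le_of_not_gt fun hxy => (hy.trans_le hx).not_ge (hF hxy.le)⟩
  refine ⟨fun h => le_trans ?_ (hF h), fun h => csInf_le hbdd h⟩
  by_contra! hlt
  have hright : ∀ᶠ y in 𝓝[>] (quantile F u), F y < u :=
    ((hrc _).mono Set.Ioi_subset_Ici_self).eventually_lt_const hlt
  obtain ⟨y, hy, hqy⟩ := (hright.and self_mem_nhdsWithin).exists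
  obtain ⟨s, hs, hsy⟩ := exists_lt_of_csInf_lt hup hqy
  exact (hy.trans_le hs).not_ge (hF hsy.le)

theorem apply_quantile {F : ℝ → ℝ} {u : ℝ} (hF : Monotone F) (hc : Continuous F)
    (hlow : ∃ x, F x < u) (hup : ∃ x, u ≤ F x) : F (quantile F u) = u := by
  have hiff : ∀ t, quantile F u ≤ t ↔ u ≤ F t := fun t =>
    quantile_le_iff hF (fun x => hc.continuousWithinAt) hlow hup
  have hleft : ∀ᶠ y in 𝓝[<] (quantile F u), F y ≤ u := by
    filter_upwards [self_mem_nhdsWithin] with y hy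
    exact le_of_not_ge fun hle => (not_le.2 hy) ((hiff y).2 hle)
  exact le_antisymm (le_of_tendsto (hc.continuousWithinAt (s := Set.Iio _)) hleft)
    ((hiff _).1 le_rfl)

theorem exists_lt_forall_le {ι : Type*} [Finite ι] (x : ι → ℝ) (q : ℝ) :
    ∃ t < q, ∀ i, x i < q → x i ≤ t := by
  have hev : ∀ᶠ t in 𝓝[<] q, ∀ i, x i < q → x i ≤ t := eventually_all.2 fun i => by
    by_cases h : x i < q
    · filter_upwards [mem_nhdsWithin_of_mem_nhds (Ioi_mem_nhds h)] with t ht _ using le_of_lt ht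
    · exact Eventually.of_forall fun t hlt => absurd hlt h
  obtain ⟨t, ht, htq⟩ := (hev.and self_mem_nhdsWithin).exists
  exact ⟨t, htq, ht⟩

variable {n : ℕ} {x : Fin n → ℝ}

theorem mul_empDistFun (hn : 1 ≤ n) (x : Fin n → ℝ) (t : ℝ) :
    n * empDistFun x t = groupCount Finset.univ x t :=
  mul_inv_cancel_left₀ (by positivity) _

theorem empDistFun_mono (x : Fin n → ℝ) : Monotone (empDistFun x) := fun _ _ hst =>
  mul_le_mul_of_nonneg_left (groupCount_mono hst) (by positivity)

theorem continuousWithinAt_empDistFun (x : Fin n → ℝ) (t : ℝ) :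
    ContinuousWithinAt (empDistFun x) (Set.Ici t) t := by
  refine tendsto_const_nhds.mul (tendsto_finsetSum _ fun i _ => tendsto_const_nhds.congr' ?_)
  by_cases h : x i ≤ t
  · filter_upwards [self_mem_nhdsWithin] with s hs
    simp [h, h.trans hs]
  · filter_upwards [mem_nhdsWithin_of_mem_nhds (Iio_mem_nhds (not_le.1 h))] with s hs
    simp [h, not_le.2 (Set.mem_Iio.1 hs)]

theorem empQuantile_le_iff (hn : 1 ≤ n) {u t : ℝ} (hu : u ∈ Set.Ioo (0 : ℝ) 1) :
    empQuantile x u ≤ t ↔ u ≤ empDistFun x t := by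
  have hn0 : (n : ℝ) ≠ 0 := by positivity
  have : Nonempty (Fin n) := ⟨⟨0, hn⟩⟩
  refine quantile_le_iff (empDistFun_mono x) (continuousWithinAt_empDistFun x) ?_ ?_
  · obtain ⟨y, hy⟩ := (Set.finite_range x).bddBelow
    have hlt : ∀ i, ¬ x i ≤ y - 1 := fun i h => by linarith [hy (Set.mem_range_self i)]
    exact ⟨y - 1, by simpa [empDistFun, hlt] using hu.1⟩
  · obtain ⟨y, hy⟩ := (Set.finite_range x).bddAbove
    have hle : ∀ i, x i ≤ y := fun i => hy (Set.mem_range_self i)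
    exact ⟨y, by simpa [empDistFun, hle, hn0] using hu.2.le⟩

theorem empQuantile_lt_iff (hn : 1 ≤ n) {u q : ℝ} (hu : u ∈ Set.Ioo (0 : ℝ) 1)
    (hq : ∀ i, x i ≠ q) : empQuantile x u < q ↔ u ≤ empDistFun x q := by
  refine ⟨fun h => (empQuantile_le_iff hn hu).1 h.le, fun h => ?_⟩
  obtain ⟨t, htq, ht⟩ := exists_lt_forall_le x q
  have hsame : empDistFun x q = empDistFun x t := by
    have hiff : ∀ i, x i ≤ q ↔ x i ≤ t := fun i =>
      ⟨fun hi => ht i (hi.lt_of_ne (hq i)), fun hi => hi.trans htq.le⟩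
    simp only [empDistFun, hiff]
  exact ((empQuantile_le_iff hn hu).2 (h.trans_eq hsame)).trans_lt htq

theorem abs_mul_empDistFun_empQuantile_sub_le (hn : 1 ≤ n) {u : ℝ} (hu : u ∈ Set.Ioo (0 : ℝ) 1)
    (hx : Function.Injective x) : |(n : ℝ) * (empDistFun x (empQuantile x u) - u)| ≤ 1 := by
  set q := empQuantile x u
  have hright : u ≤ empDistFun x q := (empQuantile_le_iff hn hu).1 le_rfl
  obtain ⟨t, htq, ht⟩ := exists_lt_forall_le x q
  have hleft : empDistFun x t < u :=
    lt_of_not_ge fun h => htq.not_ge ((empQuantile_le_iff hn hu).2 h)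
  have hties : ∑ i, (if x i = q then (1 : ℝ) else 0) ≤ 1 := by
    rw [Finset.sum_boole]
    refine mod_cast Finset.card_le_one.2 fun i hi j hj => ?_
    rw [Finset.mem_filter] at hi hj
    exact hx (hi.2.trans hj.2.symm)
  have hjump : groupCount Finset.univ x q
      ≤ groupCount Finset.univ x t + ∑ i, if x i = q then (1 : ℝ) else 0 := by
    rw [groupCount, groupCount, ← Finset.sum_add_distrib]
    refine Finset.sum_le_sum fun i _ => ?_
    rcases lt_trichotomy (x i) q with hlt | heq | hgt
    · simp [hlt.le, hlt.ne, ht i hlt]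
    · simp [heq, htq.not_ge]
    · simp [hgt.not_ge, hgt.ne', (htq.trans hgt).not_ge]
  rw [← mul_empDistFun hn, ← mul_empDistFun hn] at hjump
  have htu : n * empDistFun x t ≤ n * u := by gcongr
  have huq : n * u ≤ n * empDistFun x q := by gcongr
  rw [mul_sub, abs_of_nonneg (sub_nonneg.2 huq)]
  linarith

end Quantiles

section RandomSample

variable {n : ℕ} {x : Fin n → ℝ} {I : Finpartition (Finset.univ : Finset (Fin n))}

theorem mul_varEst (hn : 1 ≤ n) (x : Fin n → ℝ) (τ : ℝ) :
    n * varEst I x τ = pooledStat I x (empQuantile x τ) := by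
  rw [varEst, mul_inv_cancel_left₀ (by positivity)]
  simp only [sum_sum_ite_le_and_lt, pooledStat, groupStat]

theorem varEst_le (hI : ∀ J ∈ I.parts, 2 ≤ J.card) (hn : 1 ≤ n) (τ : ℝ) :
    varEst I x τ ≤ 1 / 2 := by
  have hn0 : (0 : ℝ) < n := by positivity
  have hle : n * varEst I x τ ≤ n / 2 := by
    simpa [mul_varEst hn] using pooledStat_le (x := x) (q := empQuantile x τ) hI
  nlinarith

variable {Ω : Type*} [MeasurableSpace Ω] {P : Measure Ω} {X : Fin n → Ω → ℝ}

theorem measurable_empDistFun (hX : ∀ i, Measurable (X i)) (t : ℝ) :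
    Measurable fun ω => empDistFun (fun i => X i ω) t :=
  (measurable_groupCount hX Finset.univ t).const_mul _

theorem measurable_empQuantile (hX : ∀ i, Measurable (X i)) (hn : 1 ≤ n) {u : ℝ}
    (hu : u ∈ Set.Ioo (0 : ℝ) 1) : Measurable fun ω => empQuantile (fun i => X i ω) u := by
  refine measurable_of_Iic fun t => ?_
  have hpre : (fun ω => empQuantile (fun i => X i ω) u) ⁻¹' Set.Iic t
      = {ω | u ≤ empDistFun (fun i => X i ω) t} := Set.ext fun ω => empQuantile_le_iff hn hu
  rw [hpre]
  exact measurableSet_le measurable_const (measurable_empDistFun hX t)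

theorem measurable_varEst (hX : ∀ i, Measurable (X i)) {u : ℝ} (hu : u ∈ Set.Ioo (0 : ℝ) 1)
    (I : Finpartition (Finset.univ : Finset (Fin n))) :
    Measurable fun ω => varEst I (fun i => X i ω) u := by
  rcases Nat.eq_zero_or_pos n with rfl | hn
  · simp only [varEst, Nat.cast_zero, inv_zero, zero_mul]
    exact measurable_const
  have hq := measurable_empQuantile hX hn hu
  refine Measurable.const_mul (Finset.measurable_sum _ fun J _ => Measurable.const_mul
    (Finset.measurable_sum _ fun k _ => Finset.measurable_sum _ fun l _ => ?_) _) _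
  exact Measurable.ite ((measurableSet_le (hX k) hq).inter (measurableSet_lt hq (hX l)))
    measurable_const measurable_const

theorem avgDistFun_mono : Monotone (avgDistFun P X) := fun _ _ hst =>
  mul_le_mul_of_nonneg_left (Finset.sum_le_sum fun i _ => monotone_cdf _ hst) (by positivity)

theorem avgDistFun_avgQuantile (hn : 1 ≤ n) (hc : Continuous (avgDistFun P X))
    {u : ℝ} (hu : u ∈ Set.Ioo (0 : ℝ) 1) : avgDistFun P X (avgQuantile P X u) = u := by
  have hn0 : (n : ℝ) ≠ 0 := by positivity
  have hbot : Tendsto (avgDistFun P X) atBot (𝓝 ((n : ℝ)⁻¹ * ∑ _i : Fin n, (0 : ℝ))) :=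
    tendsto_const_nhds.mul (tendsto_finsetSum _ fun i _ => tendsto_cdf_atBot _)
  have htop : Tendsto (avgDistFun P X) atTop (𝓝 ((n : ℝ)⁻¹ * ∑ _i : Fin n, (1 : ℝ))) :=
    tendsto_const_nhds.mul (tendsto_finsetSum _ fun i _ => tendsto_cdf_atTop _)
  exact apply_quantile avgDistFun_mono hc
    (hbot.eventually_lt_const (by simpa using hu.1)).exists
    ((htop.eventually_const_lt (by simpa [hn0] using hu.2)).exists.imp fun _ h => h.le)

theorem mul_avgVar (hn : 1 ≤ n) (τ : ℝ) :
    n * avgVar P X τ = sumVar P X Finset.univ (avgQuantile P X τ) :=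
  mul_inv_cancel_left₀ (by positivity) _

theorem sum_centeredInd_avgQuantile (hn : 1 ≤ n) (hc : Continuous (avgDistFun P X)) {τ : ℝ}
    (hτ : τ ∈ Set.Ioo (0 : ℝ) 1) (ω : Ω) :
    ∑ i, centeredInd P (X i) (avgQuantile P X τ) ω
      = n * (empDistFun (fun i => X i ω) (avgQuantile P X τ) - τ) := by
  have hsum : ∑ i, distFun P (X i) (avgQuantile P X τ) = n * τ := by
    conv_rhs => rw [← avgDistFun_avgQuantile hn hc hτ]
    exact (mul_inv_cancel_left₀ (by positivity) _).symm
  simp only [centeredInd]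
  rw [Finset.sum_sub_distrib, hsum, mul_sub, mul_empDistFun hn, groupCount]

theorem nullSingletonClass_map_of_continuous_avgDistFun [IsProbabilityMeasure P]
    (hX : ∀ i, Measurable (X i)) (hc : Continuous (avgDistFun P X)) (i : Fin n) :
    NullSingletonClass (P.map (X i)) := by
  have hn0 : (n : ℝ) ≠ 0 := by
    have := i.pos
    positivity
  have := Measure.isProbabilityMeasure_map (μ := P) (hX i).aemeasurable
  refine ⟨fun q => ?_⟩
  have hdom : ∀ y < q, distFun P (X i) q - n * (avgDistFun P X q - avgDistFun P X y)
      ≤ distFun P (X i) y := fun y hy => by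
    have hterm := Finset.single_le_sum (f := fun j => distFun P (X j) q - distFun P (X j) y)
      (fun j _ => sub_nonneg.2 (monotone_cdf _ hy.le)) (Finset.mem_univ i)
    rw [Finset.sum_sub_distrib] at hterm
    rw [avgDistFun, avgDistFun, ← mul_sub, mul_inv_cancel_left₀ hn0]
    linarith
  have hlower : Tendsto (fun y => distFun P (X i) q - n * (avgDistFun P X q - avgDistFun P X y))
      (𝓝[<] q) (𝓝 (distFun P (X i) q)) := by
    have hcont : ContinuousAt
        (fun y => distFun P (X i) q - n * (avgDistFun P X q - avgDistFun P X y)) q := by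
      fun_prop
    simpa using hcont.tendsto.mono_left nhdsWithin_le_nhds
  have hleft : Tendsto (distFun P (X i)) (𝓝[<] q) (𝓝 (distFun P (X i) q)) := by
    refine tendsto_of_tendsto_of_tendsto_of_le_of_le' hlower tendsto_const_nhds ?_ ?_ <;>
      filter_upwards [self_mem_nhdsWithin] with y hy
    exacts [hdom y hy, monotone_cdf _ (le_of_lt hy)]
  have hlim : Function.leftLim (cdf (P.map (X i))) q = cdf (P.map (X i)) q :=
    tendsto_nhds_unique ((monotone_cdf _).tendsto_leftLim q) hleft
  rw [← measure_cdf (P.map (X i)), StieltjesFunction.measure_singleton, hlim, sub_self,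
    ENNReal.ofReal_zero]

end RandomSample

section Ties

variable {ι Ω : Type*} [MeasurableSpace Ω] {P : Measure Ω}

theorem ae_ne_const_of_nullSingletonClass_map {Y : Ω → ℝ} (hY : AEMeasurable Y P)
    [NullSingletonClass (P.map Y)] (q : ℝ) : ∀ᵐ ω ∂P, Y ω ≠ q :=
  ae_of_ae_map hY (p := (· ≠ q)) (by simp [ae_iff])

theorem ae_ne_of_indepFun [IsProbabilityMeasure P] {Y Z : Ω → ℝ} (hYZ : IndepFun Y Z P)
    (hY : AEMeasurable Y P) (hZ : AEMeasurable Z P) [NullSingletonClass (P.map Z)] :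
    ∀ᵐ ω ∂P, Y ω ≠ Z ω := by
  have hdiag : MeasurableSet {p : ℝ × ℝ | p.1 = p.2} :=
    measurableSet_eq_fun measurable_fst measurable_snd
  have hnull : (P.map fun ω => (Y ω, Z ω)) {p | p.1 = p.2} = 0 := by
    rw [(indepFun_iff_map_prod_eq_prod_map_map hY hZ).1 hYZ, Measure.measure_prod_null hdiag]
    refine Eventually.of_forall fun a => ?_
    have hsection : Prod.mk a ⁻¹' {p : ℝ × ℝ | p.1 = p.2} = {a} := by
      ext b
      simp [eq_comm]
    simp [hsection]
  have hae : ∀ᵐ p ∂(P.map fun ω => (Y ω, Z ω)), p.1 ≠ p.2 := by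
    simpa [ae_iff] using hnull
  exact ae_of_ae_map (hY.prodMk hZ) hae

theorem ae_injective_of_nullSingletonClass_map [Countable ι] [IsProbabilityMeasure P]
    {X : ι → Ω → ℝ} (hind : iIndepFun X P) (hX : ∀ i, AEMeasurable (X i) P)
    (hnull : ∀ i, NullSingletonClass (P.map (X i))) :
    ∀ᵐ ω ∂P, Function.Injective fun i => X i ω := by
  have hne : ∀ᵐ ω ∂P, ∀ i j, i ≠ j → X i ω ≠ X j ω := by
    simp only [ae_all_iff]
    exact fun i j hij => ae_ne_of_indepFun (hind.indepFun hij) (hX i) (hX j)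
  filter_upwards [hne] with ω hω i j hij
  exact not_imp_not.1 (hω i j) hij

end Ties

section RatioConsistency

variable {n : ℕ}

theorem abs_mul_varEst_sub_pooledStat_le {x : Fin n → ℝ}
    {I : Finpartition (Finset.univ : Finset (Fin n))} (hI : ∀ J ∈ I.parts, 2 ≤ J.card)
    (hn : 1 ≤ n) {τ : ℝ} (hτ : τ ∈ Set.Ioo (0 : ℝ) 1) (hx : Function.Injective x) (q : ℝ) :
    |n * varEst I x τ - pooledStat I x q| ≤ 2 * (1 + |n * (empDistFun x q - τ)|) := by
  have hcount : |groupCount Finset.univ x (empQuantile x τ) - groupCount Finset.univ x q|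
      ≤ 1 + |n * (empDistFun x q - τ)| := by
    rw [← mul_empDistFun hn, ← mul_empDistFun hn]
    calc |n * empDistFun x (empQuantile x τ) - n * empDistFun x q|
        = |n * (empDistFun x (empQuantile x τ) - τ) - n * (empDistFun x q - τ)| := by
          congr 1
          ring
      _ ≤ |n * (empDistFun x (empQuantile x τ) - τ)| + |n * (empDistFun x q - τ)| := abs_sub _ _
      _ ≤ 1 + |n * (empDistFun x q - τ)| := by
          gcongr
          exact abs_mul_empDistFun_empQuantile_sub_le hn hτ hx
  rw [mul_varEst hn]
  exact (abs_pooledStat_sub_le hI q _).trans (by gcongr)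

theorem IsGrouping.measureReal_varEst_ge_le {Ω : Type*} [MeasurableSpace Ω] {P : Measure Ω}
    [IsProbabilityMeasure P] {X : Fin n → Ω → ℝ}
    {I : Finpartition (Finset.univ : Finset (Fin n))} (hI : IsGrouping P X I)
    (hX : ∀ i, Measurable (X i)) (hind : iIndepFun X P) (hc : Continuous (avgDistFun P X))
    (hn : 1 ≤ n) {τ c : ℝ} (hτ : τ ∈ Set.Ioo (0 : ℝ) 1) (hc6 : 6 ≤ c) :
    P.real {ω | c ≤ |n * varEst I (fun i => X i ω) τ - n * avgVar P X τ|}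
      ≤ 45 * (n * avgVar P X τ) / c ^ 2 := by
  set q := avgQuantile P X τ with hq
  have hcover : {ω | c ≤ |n * varEst I (fun i => X i ω) τ - n * avgVar P X τ|} ≤ᵐ[P]
      ({ω | c / 3 ≤ |pooledStat I (fun i => X i ω) q - sumVar P X Finset.univ q|} ∪
        {ω | c / 6 ≤ |∑ i, centeredInd P (X i) q ω|} : Set Ω) := by
    filter_upwards [ae_injective_of_nullSingletonClass_map hind (fun i => (hX i).aemeasurable)
      (nullSingletonClass_map_of_continuous_avgDistFun hX hc)] with ω hω hmem
    have hest := abs_mul_varEst_sub_pooledStat_le hI.two_le_card hn hτ hω q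
    rw [← sum_centeredInd_avgQuantile hn hc hτ] at hest
    have htri := abs_sub_le (n * varEst I (fun i => X i ω) τ)
      (pooledStat I (fun i => X i ω) q) (sumVar P X Finset.univ q)
    change c ≤ _ at hmem
    rw [mul_avgVar hn, ← hq] at hmem
    change c / 3 ≤ _ ∨ c / 6 ≤ _
    by_contra! hsmall
    linarith
  have hpooled := hI.measureReal_pooledStat_ge_le (q := q) hX hind (c := c / 3) (by linarith)
  have hlinear := measureReal_sum_centeredInd_ge_le (s := Finset.univ) (q := q) hX hind
    (c := c / 6) (by linarith)
  calc P.real {ω | c ≤ |n * varEst I (fun i => X i ω) τ - n * avgVar P X τ|}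
      ≤ _ := ENNReal.toReal_mono (measure_ne_top _ _) (measure_mono_ae hcover)
    _ ≤ _ := measureReal_union_le _ _
    _ ≤ _ := add_le_add hpooled hlinear
    _ = 45 * (n * avgVar P X τ) / c ^ 2 := by
      rw [mul_avgVar hn, ← hq]
      field_simp
      norm_num

variable {Ω : ℕ → Type*} [∀ n, MeasurableSpace (Ω n)] {P : (n : ℕ) → Measure (Ω n)}
  [∀ n, IsProbabilityMeasure (P n)] {X : (n : ℕ) → Fin n → Ω n → ℝ}
  {I : (n : ℕ) → Finpartition (Finset.univ : Finset (Fin n))} {τ : ℝ}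

theorem tendstoInProbConst_varEst_div_avgVar (hX : ∀ n i, Measurable (X n i))
    (hind : ∀ n, iIndepFun (X n) (P n)) (hI : ∀ᶠ n in atTop, IsGrouping (P n) (X n) (I n))
    (hc : ∀ᶠ n in atTop, Continuous (avgDistFun (P n) (X n))) (hτ : τ ∈ Set.Ioo (0 : ℝ) 1)
    (hV : Tendsto (fun n : ℕ => (n : ℝ) * avgVar (P n) (X n) τ) atTop atTop) :
    TendstoInProbConst P
      (fun n ω => n * varEst (I n) (fun i => X n i ω) τ / (n * avgVar (P n) (X n) τ))
      atTop 1 := by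
  intro δ hδ
  have hbound : Tendsto (fun n : ℕ => 45 / δ ^ 2 / (n * avgVar (P n) (X n) τ)) atTop (𝓝 0) :=
    hV.const_div_atTop _
  refine squeeze_zero' (Eventually.of_forall fun n => measureReal_nonneg) ?_ hbound
  filter_upwards [hI, hc, eventually_ge_atTop 1, hV.eventually_gt_atTop 0,
    hV.eventually_ge_atTop (6 / δ)] with n hIn hcn hn hV0 hV6
  rw [div_le_iff₀' hδ] at hV6
  set v := n * avgVar (P n) (X n) τ
  have hevent : {ω | δ ≤ dist (n * varEst (I n) (fun i => X n i ω) τ / v) 1}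
      = {ω | δ * v ≤ |n * varEst (I n) (fun i => X n i ω) τ - v|} := by
    ext ω
    rw [Set.mem_ofPred_eq, Set.mem_ofPred_eq, Real.dist_eq, div_sub_one hV0.ne', abs_div,
      abs_of_pos hV0, le_div_iff₀ hV0]
  rw [hevent]
  refine (hIn.measureReal_varEst_ge_le (hX n) (hind n) hcn hn hτ hV6).trans_eq ?_
  change 45 * v / (δ * v) ^ 2 = 45 / δ ^ 2 / v
  field_simp

end RatioConsistency

section Studentization

theorem sqrt_div_mul_eq {m v : ℝ} (hm : 0 ≤ m) (hv : 0 < v) (V y : ℝ) :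
    √(m / V) * y = (√(m * V / v))⁻¹ * ((√v)⁻¹ * (m * y)) := by
  have hv0 : √v ≠ 0 := (Real.sqrt_pos.2 hv).ne'
  rw [Real.sqrt_div hm, Real.sqrt_div' _ hv.le, Real.sqrt_mul hm]
  rcases eq_or_ne (√V) 0 with hV | hV
  · simp [hV]
  rcases eq_or_ne (√m) 0 with hm0 | hm0
  · simp [hm0]
  field_simp
  rw [Real.sq_sqrt hm, mul_comm]

variable {Ω : ℕ → Type*} [∀ n, MeasurableSpace (Ω n)] {P : (n : ℕ) → Measure (Ω n)}
  [∀ n, IsProbabilityMeasure (P n)] {X : (n : ℕ) → Fin n → Ω n → ℝ}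
  {I : (n : ℕ) → Finpartition (Finset.univ : Finset (Fin n))} {τ : ℝ}

theorem tendstoInDistribution_sum_centeredInd {ι : ℕ → Type*} [∀ n, Fintype (ι n)]
    {X : (n : ℕ) → ι n → Ω n → ℝ} (hX : ∀ n i, Measurable (X n i))
    (hind : ∀ n, iIndepFun (X n) (P n)) {q : ℕ → ℝ}
    (hV : Tendsto (fun n => sumVar (P n) (X n) Finset.univ (q n)) atTop atTop) :
    TendstoInDistribution
      (fun n ω => (√(sumVar (P n) (X n) Finset.univ (q n)))⁻¹ *
        ∑ i, centeredInd (P n) (X n i) (q n) ω)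
      atTop (id : ℝ → ℝ) P (gaussianReal 0 1) := by
  have hvar : ∀ n, sumVar (P n) (X n) Finset.univ (q n)
      = ∑ i, Var[centeredInd (P n) (X n i) (q n); P n] := fun n =>
    Finset.sum_congr rfl fun i _ => (variance_centeredInd (hX n i)).symm
  simp only [hvar] at hV ⊢
  exact tendstoInDistribution_gaussianReal_of_bounded
    (fun n i => (measurable_centeredInd (hX n i)).aemeasurable)
    (fun n => iIndepFun_centeredInd (hind n) (q n))
    (fun n i => Eventually.of_forall abs_centeredInd_le)
    (fun n i => integral_centeredInd (hX n i)) hV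

theorem tendstoInDistribution_studentized (hX : ∀ n i, Measurable (X n i))
    (hind : ∀ n, iIndepFun (X n) (P n)) (hI : ∀ᶠ n in atTop, IsGrouping (P n) (X n) (I n))
    (hc : ∀ᶠ n in atTop, Continuous (avgDistFun (P n) (X n))) (hτ : τ ∈ Set.Ioo (0 : ℝ) 1)
    (hV : Tendsto (fun n : ℕ => (n : ℝ) * avgVar (P n) (X n) τ) atTop atTop) :
    TendstoInDistribution
      (fun n ω => √(n / varEst (I n) (fun i => X n i ω) τ) *
        (empDistFun (fun i => X n i ω) (avgQuantile (P n) (X n) τ) - τ))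
      atTop (id : ℝ → ℝ) P (gaussianReal 0 1) := by
  have hVsum : Tendsto
      (fun n => sumVar (P n) (X n) Finset.univ (avgQuantile (P n) (X n) τ)) atTop atTop :=
    hV.congr' ((eventually_ge_atTop 1).mono fun n hn => mul_avgVar hn τ)
  have hnum := tendstoInDistribution_sum_centeredInd hX hind hVsum
  have hden := (tendstoInProbConst_varEst_div_avgVar hX hind hI hc hτ hV).comp_continuousAt
    (g := fun w => (√w)⁻¹) (Real.continuous_sqrt.continuousAt.inv₀ (by simp))
  have hVm : ∀ n, Measurable fun ω => varEst (I n) (fun i => X n i ω) τ := fun n =>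
    measurable_varEst (hX n) hτ (I n)
  have hdenm : ∀ n, Measurable fun ω =>
      (√(n * varEst (I n) (fun i => X n i ω) τ / (n * avgVar (P n) (X n) τ)))⁻¹ := fun n =>
    (((hVm n).const_mul _).div_const _).sqrt.inv
  have hprod := hden.mul_tendstoInDistribution (fun n => (hdenm n).aemeasurable) hnum
  simp only [Real.sqrt_one, inv_one, one_mul] at hprod
  refine tendstoInDistribution_of_eventually_map_eq hprod (fun n => ?_) ?_
  · exact (((hVm n).const_div _).sqrt.mul
      ((measurable_empDistFun (hX n) _).sub_const _)).aemeasurable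
  · filter_upwards [hc, eventually_ge_atTop 1, hV.eventually_gt_atTop 0] with n hcn hn hV0
    simp only [sqrt_div_mul_eq (Nat.cast_nonneg n) hV0,
      sum_centeredInd_avgQuantile hn hcn hτ, mul_avgVar hn]

end Studentization

section SymmetricQuantiles

variable {μ : Measure ℝ} [IsProbabilityMeasure μ]

theorem measureReal_Iio_neg [μ.IsNegInvariant] (z : ℝ) :
    μ.real (Set.Iio (-z)) = 1 - cdf μ z := by
  have hpre : Set.Iio (-z) = -(Set.Iic z)ᶜ := by
    ext x
    simp
  rw [hpre, Measure.real, Measure.measure_neg, ← Measure.real,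
    probReal_compl_eq_one_sub measurableSet_Iic, cdf_eq_real]

variable [NullSingletonClass μ]

theorem continuous_cdf : Continuous (cdf μ) := by
  refine continuous_iff_continuousAt.2 fun a => ?_
  rw [(monotone_cdf μ).continuousAt_iff_leftLim_eq_rightLim, StieltjesFunction.rightLim_eq]
  refine le_antisymm ((monotone_cdf μ).leftLim_le le_rfl) ?_
  have hnull := measure_singleton (μ := μ) a
  rw [← measure_cdf μ, StieltjesFunction.measure_singleton, ENNReal.ofReal_eq_zero] at hnull
  linarith

theorem cdf_quantile {u : ℝ} (hu : u ∈ Set.Ioo (0 : ℝ) 1) : cdf μ (quantile (cdf μ) u) = u :=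
  apply_quantile (monotone_cdf μ) continuous_cdf
    ((tendsto_cdf_atBot μ).eventually_lt_const hu.1).exists
    (((tendsto_cdf_atTop μ).eventually_const_lt hu.2).exists.imp fun _ h => h.le)

theorem measureReal_Iio_eq_cdf (z : ℝ) : μ.real (Set.Iio z) = cdf μ z := by
  rw [cdf_eq_real]
  exact measureReal_congr Iio_ae_eq_Iic

variable [μ.IsNegInvariant]

theorem quantile_cdf_nonneg {u : ℝ} (hu : u ∈ Set.Ioo (1 / 2 : ℝ) 1) :
    0 ≤ quantile (cdf μ) u := by
  by_contra! hneg
  have hle := measureReal_mono (μ := μ)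
    (Set.Iio_subset_Iio (show quantile (cdf μ) u ≤ -quantile (cdf μ) u by linarith))
  rw [measureReal_Iio_eq_cdf, measureReal_Iio_neg, cdf_quantile ⟨by linarith [hu.1], hu.2⟩] at hle
  linarith [hu.1]

theorem measureReal_Ico_neg_quantile_cdf {u : ℝ} (hu : u ∈ Set.Ioo (1 / 2 : ℝ) 1) :
    μ.real (Set.Ico (-quantile (cdf μ) u) (quantile (cdf μ) u)) = 2 * u - 1 := by
  set z := quantile (cdf μ) u with hz
  have hz0 : 0 ≤ z := quantile_cdf_nonneg hu
  have hdisj : Disjoint (Set.Iio (-z)) (Set.Ico (-z) z) :=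
    Set.disjoint_left.2 fun x hx hx' => hx'.1.not_gt hx
  have hunion := measureReal_union (μ := μ) hdisj measurableSet_Ico
  rw [Set.Iio_union_Ico_eq_Iio (by linarith), measureReal_Iio_eq_cdf, measureReal_Iio_neg,
    hz, cdf_quantile ⟨by linarith [hu.1], hu.2⟩] at hunion
  linarith

theorem tendsto_measureReal_Ico_neg_quantile_cdf {ι : Type*} {l : Filter ι} {Ω : ι → Type*}
    {mΩ : ∀ i, MeasurableSpace (Ω i)} {P : (i : ι) → Measure (Ω i)}
    [∀ i, IsProbabilityMeasure (P i)] {T : (i : ι) → Ω i → ℝ}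
    (hT : TendstoInDistribution T l (id : ℝ → ℝ) P μ) {u : ℝ} (hu : u ∈ Set.Ioo (1 / 2 : ℝ) 1) :
    Tendsto
      (fun i => (P i).real {ω | T i ω ∈ Set.Ico (-quantile (cdf μ) u) (quantile (cdf μ) u)})
      l (𝓝 (2 * u - 1)) := by
  have hfrontier : frontier (Set.Ico (-quantile (cdf μ) u) (quantile (cdf μ) u))
      ⊆ {-quantile (cdf μ) u, quantile (cdf μ) u} := by
    rcases (quantile_cdf_nonneg (μ := μ) hu).eq_or_lt with hz | hz
    · simp [← hz]
    · exact (frontier_Ico (by linarith)).subset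
  have hlim := tendsto_measureReal_of_tendstoInDistribution hT measurableSet_Ico (by
    rw [Measure.map_id]
    exact measure_mono_null hfrontier ((Set.toFinite _).measure_zero μ))
  rwa [Measure.map_id, measureReal_Ico_neg_quantile_cdf hu] at hlim

instance isNegInvariant_gaussianReal (v : NNReal) : (gaussianReal 0 v).IsNegInvariant :=
  ⟨gaussianReal_map_neg.trans (by rw [neg_zero])⟩

end SymmetricQuantiles

section Coverage

theorem abs_measureReal_sub_le_of_ae_iff {Ω : Type*} [MeasurableSpace Ω] {P : Measure Ω}
    [IsFiniteMeasure P] {A B C : Set Ω} (h : ∀ᵐ ω ∂P, ω ∉ C → (ω ∈ A ↔ ω ∈ B)) :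
    |P.real A - P.real B| ≤ P.real C := by
  have hle : ∀ {A B : Set Ω}, (∀ᵐ ω ∂P, ω ∉ C → (ω ∈ A ↔ ω ∈ B)) →
      P.real A ≤ P.real B + P.real C := fun {A B} h => by
    have hsub : A ≤ᵐ[P] (B ∪ C : Set Ω) := by
      filter_upwards [h] with ω hω hA
      exact or_iff_not_imp_right.2 fun hC => (hω hC).1 hA
    exact (ENNReal.toReal_mono (measure_ne_top _ _) (measure_mono_ae hsub)).trans
      (measureReal_union_le _ _)
  have hAB := hle h
  have hBA := hle (h.mono fun ω hω hC => (hω hC).symm)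
  exact abs_le.2 ⟨by linarith, by linarith⟩

theorem empQuantile_lt_and_lt_empQuantile_iff {n : ℕ} (hn : 1 ≤ n) {x : Fin n → ℝ}
    {τ V z q : ℝ} (hV : 0 < V) (hq : ∀ i, x i ≠ q)
    (hleft : τ - √(V / n) * z ∈ Set.Ioo (0 : ℝ) 1)
    (hright : τ + √(V / n) * z ∈ Set.Ioo (0 : ℝ) 1) :
    (empQuantile x (τ - √(V / n) * z) < q ∧ q < empQuantile x (τ + √(V / n) * z)) ↔
      √(n / V) * (empDistFun x q - τ) ∈ Set.Ico (-z) z := by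
  have hw : 0 < √(V / n) := Real.sqrt_pos.2 (by positivity)
  have hinv : √(n / V) = (√(V / n))⁻¹ := by rw [← Real.sqrt_inv, inv_div]
  rw [empQuantile_lt_iff hn hleft hq, ← not_le, empQuantile_le_iff hn hright, not_le, Set.mem_Ico,
    hinv, inv_mul_lt_iff₀ hw, le_inv_mul_iff₀ hw]
  constructor <;> rintro ⟨hlo, hhi⟩ <;> constructor <;> linarith

theorem eventually_sqrt_div_mul_lt {c : ℝ} (hc : 0 < c) {z : ℝ} (hz : 0 ≤ z) {b : ℝ} :
    ∀ᶠ n : ℕ in atTop, ∀ V ≤ b, √(V / n) * z < c := by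
  have hlim : Tendsto (fun n : ℕ => √(b / n) * z) atTop (𝓝 0) := by
    simpa using (((tendsto_const_div_atTop_nhds_zero_nat b).sqrt).mul_const z)
  filter_upwards [hlim.eventually_lt_const hc] with n hn V hV
  exact lt_of_le_of_lt (by gcongr) hn

variable {Ω : ℕ → Type*} [∀ n, MeasurableSpace (Ω n)] {P : (n : ℕ) → Measure (Ω n)}
  [∀ n, IsProbabilityMeasure (P n)] {X : (n : ℕ) → Fin n → Ω n → ℝ}
  {I : (n : ℕ) → Finpartition (Finset.univ : Finset (Fin n))} {τ : ℝ}

theorem tendsto_measureReal_varEst_nonpos (hX : ∀ n i, Measurable (X n i))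
    (hind : ∀ n, iIndepFun (X n) (P n)) (hI : ∀ᶠ n in atTop, IsGrouping (P n) (X n) (I n))
    (hc : ∀ᶠ n in atTop, Continuous (avgDistFun (P n) (X n))) (hτ : τ ∈ Set.Ioo (0 : ℝ) 1)
    (hV : Tendsto (fun n : ℕ => (n : ℝ) * avgVar (P n) (X n) τ) atTop atTop) :
    Tendsto (fun n => (P n).real {ω | varEst (I n) (fun i => X n i ω) τ ≤ 0}) atTop (𝓝 0) := by
  refine squeeze_zero' (Eventually.of_forall fun n => measureReal_nonneg) ?_
    (tendstoInProbConst_varEst_div_avgVar hX hind hI hc hτ hV 1 one_pos)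
  filter_upwards [hV.eventually_gt_atTop 0] with n hV0
  refine measureReal_mono fun ω hω => ?_
  have hratio : n * varEst (I n) (fun i => X n i ω) τ / (n * avgVar (P n) (X n) τ) ≤ 0 :=
    div_nonpos_of_nonpos_of_nonneg (mul_nonpos_of_nonneg_of_nonpos (by positivity) hω) hV0.le
  rw [Set.mem_ofPred_eq, dist_comm, Real.dist_eq]
  exact le_trans (by linarith) (le_abs_self _)

theorem tendsto_measureReal_quantile_interval (hX : ∀ n i, Measurable (X n i))
    (hind : ∀ n, iIndepFun (X n) (P n)) (hI : ∀ᶠ n in atTop, IsGrouping (P n) (X n) (I n))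
    (hc : ∀ᶠ n in atTop, Continuous (avgDistFun (P n) (X n))) (hτ : τ ∈ Set.Ioo (0 : ℝ) 1)
    (hV : Tendsto (fun n : ℕ => (n : ℝ) * avgVar (P n) (X n) τ) atTop atTop)
    {α : ℝ} (hα : α ∈ Set.Ioo (0 : ℝ) 1) :
    Tendsto (fun n => (P n).real {ω |
        empQuantile (fun i => X n i ω) (τ - halfWidth (I n) (fun i => X n i ω) τ α)
            < avgQuantile (P n) (X n) τ ∧
          avgQuantile (P n) (X n) τ
            < empQuantile (fun i => X n i ω) (τ + halfWidth (I n) (fun i => X n i ω) τ α)})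
      atTop (𝓝 (1 - α)) := by
  have hns : NullSingletonClass (gaussianReal 0 1) := nullSingletonClass_gaussianReal one_ne_zero
  have hu : 1 - α / 2 ∈ Set.Ioo (1 / 2 : ℝ) 1 := ⟨by linarith [hα.2], by linarith [hα.1]⟩
  have hlim := tendsto_measureReal_Ico_neg_quantile_cdf
    (tendstoInDistribution_studentized hX hind hI hc hτ hV) hu
  rw [show 2 * (1 - α / 2) - 1 = 1 - α by ring] at hlim
  refine tendsto_of_tendsto_of_dist hlim (squeeze_zero' (Eventually.of_forall fun n => dist_nonneg)
    ?_ (tendsto_measureReal_varEst_nonpos hX hind hI hc hτ hV))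
  filter_upwards [hI, hc, eventually_ge_atTop 1, eventually_sqrt_div_mul_lt (b := 1 / 2)
    (lt_min hτ.1 (sub_pos.2 hτ.2)) (quantile_cdf_nonneg (μ := gaussianReal 0 1) hu)]
    with n hIn hcn hn hwidth
  rw [dist_comm, Real.dist_eq]
  refine abs_measureReal_sub_le_of_ae_iff ?_
  filter_upwards [ae_all_iff.2 fun i =>
    have := nullSingletonClass_map_of_continuous_avgDistFun (hX n) hcn i
    ae_ne_const_of_nullSingletonClass_map (hX n i).aemeasurable (avgQuantile (P n) (X n) τ)]
    with ω hω hpos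
  have hlt := hwidth _ (varEst_le (x := fun i => X n i ω) hIn.two_le_card hn τ)
  have hnn : 0 ≤ √(varEst (I n) (fun i => X n i ω) τ / n) *
      quantile (cdf (gaussianReal 0 1)) (1 - α / 2) :=
    mul_nonneg (Real.sqrt_nonneg _) (quantile_cdf_nonneg hu)
  obtain ⟨hlt₀, hlt₁⟩ := lt_min_iff.1 hlt
  exact empQuantile_lt_and_lt_empQuantile_iff hn (not_le.1 hpos) hω
    ⟨by linarith, by linarith [hτ.2]⟩ ⟨by linarith [hτ.1], by linarith⟩

end Coverage

end HetQuantile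

theorem theorem1
    {Ω : ℕ → Type*} [∀ n, MeasurableSpace (Ω n)]
    (P : (n : ℕ) → Measure (Ω n)) [∀ n, IsProbabilityMeasure (P n)]
    (X : (n : ℕ) → Fin n → Ω n → ℝ)
    (hmeas : ∀ n i, Measurable (X n i))
    (hindep : ∀ n, iIndepFun (X n) (P n))
    (hcont : ∀ n, 1 ≤ n → Continuous (avgDistFun (P n) (X n)))
    (I : (n : ℕ) → Finpartition (Finset.univ : Finset (Fin n)))
    (hcard : ∀ n, 2 ≤ n → ∀ J ∈ (I n).parts, 2 ≤ J.card)
    (hident : ∀ n, 2 ≤ n → ∀ J ∈ (I n).parts, ∀ i ∈ J, ∀ i' ∈ J,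
      distFun (P n) (X n i) = distFun (P n) (X n i'))
    (τ : ℝ) (hτ : τ ∈ Set.Ioo (0 : ℝ) 1)
    (hV : Tendsto (fun n : ℕ => (n : ℝ) * avgVar (P n) (X n) τ) atTop atTop) :
    TendstoInDistribution
      (fun (n : ℕ) (ω : Ω n) =>
        Real.sqrt ((n : ℝ) / varEst (I n) (fun i => X n i ω) τ) *
          (empDistFun (fun i => X n i ω) (avgQuantile (P n) (X n) τ) - τ))
      atTop (id : ℝ → ℝ) P (gaussianReal 0 1) ∧
    ∀ α ∈ Set.Ioo (0 : ℝ) 1,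
      Tendsto
        (fun n : ℕ => (P n).real {ω |
          empQuantile (fun i => X n i ω) (τ - halfWidth (I n) (fun i => X n i ω) τ α)
              < avgQuantile (P n) (X n) τ ∧
            avgQuantile (P n) (X n) τ
              < empQuantile (fun i => X n i ω) (τ + halfWidth (I n) (fun i => X n i ω) τ α)})
        atTop (𝓝 (1 - α)) := by
  have hI : ∀ᶠ n in atTop, IsGrouping (P n) (X n) (I n) :=
    (eventually_ge_atTop 2).mono fun n hn => ⟨hcard n hn, hident n hn⟩
  have hc : ∀ᶠ n in atTop, Continuous (avgDistFun (P n) (X n)) :=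
    (eventually_ge_atTop 1).mono hcont
  exact ⟨tendstoInDistribution_studentized hmeas hindep hI hc hτ hV,
    fun α hα => tendsto_measureReal_quantile_interval hmeas hindep hI hc hτ hV hα⟩
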